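/- Let $\nu>0$ and $0<f<1$. On the complex Hilbert space $[L^2(\mathbb R^3)]^3$, with norm $\|\mathbf u\|^2=\|u_1\|_{L^2}^2+\|u_2\|_{L^2}^2+\|u_3\|_{L^2}^2$ and coordinates $(x,y,z)$ on $\mathbb R^3$, consider the operator (the linearization of the rotating Navier--Stokes equations at the Couette flow $(y,0,0)$) $$ \mathscr L= \begin{pmatrix} \nu\Delta-y\partial_x+f\Delta^{-1}\partial_{xy} & f-1+(2-f)\Delta^{-1}\partial_x^2 & 0\\ -f+f\Delta^{-1}\partial_y^2 & \nu\Delta-y\partial_x+(2-f)\Delta^{-1}\partial_{xy} & 0\\ f\Delta^{-1}\partial_{yz} & (2-f)\Delta^{-1}\partial_{xz} & \nu\Delta-y\partial_x \end{pmatrix} $$ with domain $$ \mathcal D(\mathscr L)=\{\mathbf u\in[L^2(\mathbb R^3)]^3:\ \Delta\mathbf u\in[L^2(\mathbb R^3)]^3,\ y\partial_x\mathbf u\in[L^2(\mathbb R^3)]^3\}. $$ Here $\Delta$ and $y\partial_x$ are taken in the sense of distributions, and $\Delta^{-1}\partial_i\partial_j$ is the bounded operator on $L^2(\mathbb R^3)$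 given by the Fourier multiplier $\xi_i\xi_j/|\xi|^2$. Then $\mathscr L$ generates a $C_0$-semigroup $(e^{t\mathscr L})_{t\ge 0}$ on $[L^2(\mathbb R^3)]^3$, and its operator norm satisfies $$ \|e^{t\mathscr L}\|\le e^{t(2-f)/2}\qquad\text{for all } t\ge 0 . $$ -/

import Mathlib

open MeasureTheory Filter Topology
open scoped NNReal ENNReal SchwartzMap

noncomputable section

namespace CouetteCoriolis

/-! ## Strongly continuous semigroups -/

section Semigroup

variable {X : Type*} [NormedAddCommGroup X] [NormedSpace ℂ X]

/-- `T` is a `C₀`-semigroup of bounded operators on `X`. -/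
structure IsC0Semigroup (T : ℝ≥0 → X →L[ℂ] X) : Prop where
  map_zero : T 0 = ContinuousLinearMap.id ℂ X
  map_add : ∀ s t, T (s + t) = (T s).comp (T t)
  tendsto_zero : ∀ x, Tendsto (fun t => T t x) (𝓝 0) (𝓝 x)

/-- The unbounded operator `A` generates the `C₀`-semigroup `T`: a vector `x` lies in the domain of
`A`, with `A x = y`, if and only if `(T h x - x) / h → y` as `h ↓ 0`. -/
structure Generates (A : X →ₗ.[ℂ] X) (T : ℝ≥0 → X →L[ℂ] X) : Prop where
  isC0Semigroup : IsC0Semigroup T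
  mem_graph_iff : ∀ x y, (x, y) ∈ A.graph ↔
    Tendsto (fun h : ℝ≥0 => ((h : ℝ) : ℂ)⁻¹ • (T h x - x)) (𝓝[>] 0) (𝓝 y)

end Semigroup

/-! ## Operators on `L²(ℝ³)` -/

/-- `ℝ³`; the coordinates `x`, `y`, `z` have the indices `0`, `1`, `2`. -/
abbrev R3 : Type := EuclideanSpace ℝ (Fin 3)

/-- `L²(ℝ³)`, complex valued. -/
abbrev L2 : Type := Lp ℂ 2 (volume : Measure R3)

/-- `[L²(ℝ³)]³` with its Hilbert norm `(‖u₁‖² + ‖u₂‖² + ‖u₃‖²)^(1/2)`. -/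
abbrev L2Vec : Type := PiLp 2 (fun _ : Fin 3 => L2)

/-- The unit vector of `ℝ³` in the direction of the `i`-th coordinate. -/
def unitVec (i : Fin 3) : R3 := EuclideanSpace.single i 1

/-- The embedding of `L²(ℝ³)` into the tempered distributions. -/
def toDistr : L2 →ₗ[ℂ] 𝓢'(R3, ℂ) :=
  (Lp.toTemperedDistributionCLM ℂ (volume : Measure R3) 2).toLinearMap

theorem toDistr_injective : Function.Injective toDistr :=
  LinearMap.ker_eq_bot.mp Lp.ker_toTemperedDistributionCLM_eq_bot

/-- The realization in `L²(ℝ³)` of an operator `D` on tempered distributions: the domain consists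
of the `u ∈ L²` with `D u ∈ L²` in the sense of distributions, and the value at `u` is `D u`. -/
def l2Realization (D : 𝓢'(R3, ℂ) →ₗ[ℂ] 𝓢'(R3, ℂ)) : L2 →ₗ.[ℂ] L2 where
  domain := (LinearMap.range toDistr).comap (D ∘ₗ toDistr)
  toFun := (LinearEquiv.ofInjective toDistr toDistr_injective).symm.toLinearMap ∘ₗ
    LinearMap.restrict (D ∘ₗ toDistr) (fun _ hu => hu)

theorem mem_l2Realization_domain (D : 𝓢'(R3, ℂ) →ₗ[ℂ] 𝓢'(R3, ℂ)) (u : L2) :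
    u ∈ (l2Realization D).domain ↔ ∃ w : L2, toDistr w = D (toDistr u) := Iff.rfl

theorem toDistr_l2Realization (D : 𝓢'(R3, ℂ) →ₗ[ℂ] 𝓢'(R3, ℂ)) (u : (l2Realization D).domain) :
    toDistr (l2Realization D u) = D (toDistr u) :=
  LinearEquiv.ofInjective_symm_apply (f := toDistr) (h := toDistr_injective)
    (LinearMap.restrict (p := (LinearMap.range toDistr).comap (D ∘ₗ toDistr))
      (D ∘ₗ toDistr) (fun _ hu => hu) u)

/-- The Laplacian `Δ` on tempered distributions. -/
def laplacianDistr : 𝓢'(R3, ℂ) →ₗ[ℂ] 𝓢'(R3, ℂ) :=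
  (LineDeriv.laplacianCLM ℂ R3 𝓢'(R3, ℂ)).toLinearMap

/-- The transport operator `y ∂ₓ` on tempered distributions. -/
def yDxDistr : 𝓢'(R3, ℂ) →ₗ[ℂ] 𝓢'(R3, ℂ) :=
  (TemperedDistribution.smulLeftCLM ℂ (fun p : R3 => ((p 1 : ℝ) : ℂ))).toLinearMap ∘ₗ
    (LineDeriv.lineDerivOpCLM ℂ 𝓢'(R3, ℂ) (unitVec 0)).toLinearMap

/-- `ν Δ - y ∂ₓ` with domain `{u ∈ L² | Δ u ∈ L², y ∂ₓ u ∈ L²}`. -/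
def lStar (ν : ℝ) : L2 →ₗ.[ℂ] L2 :=
  (ν : ℂ) • l2Realization laplacianDistr - l2Realization yDxDistr

/-- The symbol `ξᵢ ξⱼ / |ξ|²` of `Δ⁻¹ ∂ᵢ ∂ⱼ`. -/
def rieszSymbol (i j : Fin 3) (ξ : R3) : ℂ := ((ξ i * ξ j / ‖ξ‖ ^ 2 : ℝ) : ℂ)

theorem memLp_rieszSymbol (i j : Fin 3) :
    MemLp (rieszSymbol i j) ∞ (volume : Measure R3) := by
  refine memLp_top_of_bound (C := 1) ?_ (Eventually.of_forall fun ξ => ?_)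
  · unfold rieszSymbol
    exact Measurable.aestronglyMeasurable (by fun_prop)
  · have hi : |ξ i| ≤ ‖ξ‖ := by simpa using PiLp.norm_apply_le ξ i
    have hj : |ξ j| ≤ ‖ξ‖ := by simpa using PiLp.norm_apply_le ξ j
    rw [rieszSymbol, Complex.norm_real, Real.norm_eq_abs, abs_div, abs_mul, abs_pow, abs_norm]
    refine div_le_one_of_le₀ ?_ (by positivity)
    rw [sq]
    exact mul_le_mul hi hj (abs_nonneg _) (norm_nonneg _)

/-- The bounded operator `Δ⁻¹ ∂ᵢ ∂ⱼ` on `L²(ℝ³)`, the Fourier multiplier with symbol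
`ξᵢ ξⱼ / |ξ|²`. -/
def invLaplacianDD (i j : Fin 3) : L2 →L[ℂ] L2 :=
  (Lp.fourierTransformₗᵢ R3 ℂ).symm.toContinuousLinearEquiv.toContinuousLinearMap ∘L
    ((ContinuousLinearMap.mul ℂ ℂ).holderL volume ∞ 2 2 (memLp_rieszSymbol i j).toLp) ∘L
    (Lp.fourierTransformₗᵢ R3 ℂ).toContinuousLinearEquiv.toContinuousLinearMap

/-- The matrix of bounded operators on `L²(ℝ³)` that collects all terms of the linearized operator
other than `ν Δ - y ∂ₓ`. -/
def lBullet (f : ℝ) : Matrix (Fin 3) (Fin 3) (L2 →L[ℂ] L2) :=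
  let a : ℂ := f
  let I : L2 →L[ℂ] L2 := ContinuousLinearMap.id ℂ L2
  !![a • invLaplacianDD 0 1, (a - 1) • I + (2 - a) • invLaplacianDD 0 0, 0;
     -(a • I) + a • invLaplacianDD 1 1, (2 - a) • invLaplacianDD 0 1, 0;
     a • invLaplacianDD 1 2, (2 - a) • invLaplacianDD 0 2, 0]

/-- The linearized operator `ℒ` on `[L²(ℝ³)]³` with domain
`{u ∈ [L²(ℝ³)]³ | Δ u, y ∂ₓ u ∈ [L²(ℝ³)]³}`; its `i`-th component is
`(ν Δ - y ∂ₓ) uᵢ + ∑ⱼ (lBullet f)ᵢⱼ uⱼ`. -/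
def linearizedOperator (ν f : ℝ) : L2Vec →ₗ.[ℂ] L2Vec where
  domain :=
    { carrier := {u | ∀ i, u i ∈ (lStar ν).domain}
      add_mem' := fun hu hv i => add_mem (hu i) (hv i)
      zero_mem' := fun _ => zero_mem _
      smul_mem' := fun c _ hu i => Submodule.smul_mem _ c (hu i) }
  toFun :=
    { toFun := fun u => WithLp.toLp 2 fun i =>
        lStar ν ⟨(u : L2Vec) i, u.2 i⟩ + ∑ j, lBullet f i j ((u : L2Vec) j)
      map_add' := by
        intro u v
        ext1 i
        have h := (lStar ν).map_add ⟨(u : L2Vec) i, u.2 i⟩ ⟨(v : L2Vec) i, v.2 i⟩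
        simp only [AddMemClass.mk_add_mk] at h
        simp only [Submodule.coe_add, PiLp.add_apply, map_add, Finset.sum_add_distrib, h]
        abel
      map_smul' := by
        intro c u
        ext1 i
        have h := (lStar ν).map_smul c ⟨(u : L2Vec) i, u.2 i⟩
        simp only [SetLike.mk_smul_mk] at h
        simp only [Submodule.coe_smul, PiLp.smul_apply, map_smul, ← Finset.smul_sum, h,
          RingHom.id_apply, smul_add] }

end CouetteCoriolis

end

/-! Split `ℒ` into the diagonal part `νΔ - y∂ₓ` and the bounded part `lBullet f`. Everything rests
on the energy inequality `Re ⟪u, ℒu⟫ ≤ (2-f)/2 ‖u‖²` on the domain, together with surjectivity of `l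
- ℒ` for large real `l`. These give generation (`exists_generates_of_dissipative`), and integrating
the energy inequality along trajectories gives the norm bound (`Generates.norm_le`).

The bounded part contributes the constant. By Plancherel its form is an integral of a form in `v ∈
ℂ³`, with coefficients depending on the direction `ξ/|ξ|`. The sharp bound of that form is
`coupling_form_le_of_unit`, a Lagrange identity combined with a reflection.

The diagonal part contributes nothing positive: `Δ` is nonpositive and `y∂ₓ` is formally
antisymmetric. Since `y` is unbounded, antisymmetry on the full distributional domain is proved with
a cutoff in `y`, which commutes with `∂ₓ` (`re_inner_yDx_eq_zero`).

Surjectivity for the diagonal part comes by duality from coercivity. Pairing `(l - νΔ + y∂ₓ)φ` with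
`(1 - κΔ)φ` controls `‖(1 - κΔ)φ‖²`, because the commutator of `Δ` and `y∂ₓ` costs only a gradient
term (`coercive_estimate`). This yields `u ∈ L²` with `Δu ∈ L²` (`exists_solution`), and the
equation then puts `y∂ₓu` in `L²`. A Neumann series adds the bounded part. -/

noncomputable section

namespace CouetteCoriolis

/-! ### Exponentials of bounded operators and limits of commuting approximations -/

section AbstractSemigroup

variable {X : Type*} [NormedAddCommGroup X] [InnerProductSpace ℂ X]

/-- A trajectory whose right derivative `u'` satisfies `Re ⟪u, u'⟫ ≤ c ‖u‖²` grows at most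
exponentially with rate `c`. -/
theorem norm_le_exp_of_re_inner_deriv_le {c T : ℝ} {u u' : ℝ → X} (hT : 0 ≤ T)
    (hcont : ContinuousOn u (Set.Icc 0 T))
    (hderiv : ∀ s ∈ Set.Ico 0 T, HasDerivWithinAt u (u' s) (Set.Ici s) s)
    (hdiss : ∀ s ∈ Set.Ico 0 T, (inner ℂ (u s) (u' s)).re ≤ c * ‖u s‖ ^ 2) :
    ‖u T‖ ≤ Real.exp (c * T) * ‖u 0‖ := by
  let _ : InnerProductSpace ℝ X := InnerProductSpace.rclikeToReal ℂ X
  have hexp : ∀ s : ℝ, HasDerivAt (fun s => Real.exp (-(2 * c) * s))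
      (Real.exp (-(2 * c) * s) * (-(2 * c))) s := fun s => by
    simpa using ((hasDerivAt_id s).const_mul (-(2 * c))).exp
  have key : Real.exp (-(2 * c) * T) * ‖u T‖ ^ 2 ≤ ‖u 0‖ ^ 2 := by
    refine image_le_of_deriv_right_le_deriv_boundary
      (f := fun s => Real.exp (-(2 * c) * s) * ‖u s‖ ^ 2)
      (f' := fun s => Real.exp (-(2 * c) * s) * (-(2 * c)) * ‖u s‖ ^ 2 +
        Real.exp (-(2 * c) * s) * (2 * inner ℝ (u s) (u' s)))
      (B := fun _ => ‖u 0‖ ^ 2) (B' := fun _ => 0) ?_ ?_ ?_ continuousOn_const ?_ ?_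
      (Set.right_mem_Icc.2 hT)
    · exact (Continuous.continuousOn (by fun_prop)).mul (hcont.norm.pow 2)
    · intro s hs
      exact (hexp s).hasDerivWithinAt.mul (hderiv s hs).norm_sq
    · simp
    · intro s _
      exact hasDerivWithinAt_const _ _ _
    · intro s hs
      have h1 : inner ℝ (u s) (u' s) = (inner ℂ (u s) (u' s)).re := rfl
      have h2 := hdiss s hs
      have h3 := (Real.exp_pos (-(2 * c) * s)).le
      rw [h1]
      nlinarith [mul_nonneg h3 (sub_nonneg.2 h2)]
  have h4 : ‖u T‖ ^ 2 ≤ (Real.exp (c * T) * ‖u 0‖) ^ 2 := by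
    have h5 : Real.exp (c * T) ^ 2 * Real.exp (-(2 * c) * T) = 1 := by
      rw [← Real.exp_nat_mul, ← Real.exp_add, ← Real.exp_zero]
      congr 1
      push_cast
      ring
    calc ‖u T‖ ^ 2 = Real.exp (c * T) ^ 2 * (Real.exp (-(2 * c) * T) * ‖u T‖ ^ 2) := by
          rw [← mul_assoc, h5, one_mul]
      _ ≤ Real.exp (c * T) ^ 2 * ‖u 0‖ ^ 2 := by gcongr
      _ = _ := by ring
  exact le_of_sq_le_sq h4 (by positivity)

variable [CompleteSpace X]

/-- The uniformly continuous semigroup `exp (t B)`. -/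
abbrev expOp (B : X →L[ℂ] X) (t : ℝ) : X →L[ℂ] X := NormedSpace.exp (t • B)

theorem hasDerivAt_expOp_apply (B : X →L[ℂ] X) (x : X) (t : ℝ) :
    HasDerivAt (fun t => expOp B t x) (expOp B t (B x)) t := by
  have h := hasDerivAt_exp_smul_const (𝕂 := ℝ) B t
  exact ((ContinuousLinearMap.apply ℂ X x).restrictScalars ℝ).hasFDerivAt.comp_hasDerivAt t h

theorem expOp_commute {B C : X →L[ℂ] X} (h : Commute B C) (s t : ℝ) :
    Commute (expOp B s) (expOp C t) :=
  ((h.smul_left s).smul_right t).exp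

theorem expOp_zero (B : X →L[ℂ] X) : expOp B 0 = ContinuousLinearMap.id ℂ X := by
  simp [expOp, NormedSpace.exp_zero]; rfl

theorem expOp_add (B : X →L[ℂ] X) (s t : ℝ) : expOp B (s + t) = (expOp B s).comp (expOp B t) := by
  have h : Commute (s • B) (t • B) := ((Commute.refl B).smul_left s).smul_right t
  unfold expOp
  let _ : NormedAlgebra ℚ (X →L[ℂ] X) := NormedAlgebra.restrictScalars ℚ ℝ _
  rw [add_smul, NormedSpace.exp_add_of_commute h]
  rfl

theorem norm_expOp_le {B : X →L[ℂ] X} {c : ℝ} (hB : ∀ x, (inner ℂ x (B x)).re ≤ c * ‖x‖ ^ 2)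
    {t : ℝ} (ht : 0 ≤ t) : ‖expOp B t‖ ≤ Real.exp (c * t) := by
  refine ContinuousLinearMap.opNorm_le_bound _ (Real.exp_pos _).le fun x => ?_
  have h := norm_le_exp_of_re_inner_deriv_le (c := c) (u := fun s => expOp B s x)
    (u' := fun s => B (expOp B s x)) ht
    (fun s _ => (hasDerivAt_expOp_apply B x s).continuousAt.continuousWithinAt)
    (fun s _ => ?_) (fun s _ => hB _)
  · simpa [expOp_zero] using h
  · have hc := expOp_commute (Commute.refl B) s 1
    have h1 : Commute (expOp B s) B := ((Commute.refl B).smul_left s).exp_left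
    have h2 : expOp B s (B x) = B (expOp B s x) := congrArg (fun L => L x) h1.eq
    rw [← h2]
    exact (hasDerivAt_expOp_apply B x s).hasDerivWithinAt

/-- Interpolate by `s ↦ e^{sB} e^{(t-s)C} x`. Because `B` and `C` commute, its derivative is `e^{sB}
e^{(t-s)C} (B - C) x`, of norm at most `e^{ct} ‖Bx - Cx‖`. Convergence of generators on a vector
thus gives convergence of the exponentials there. -/
theorem norm_expOp_sub_expOp_le {B C : X →L[ℂ] X} {c : ℝ}
    (hB : ∀ x, (inner ℂ x (B x)).re ≤ c * ‖x‖ ^ 2) (hC : ∀ x, (inner ℂ x (C x)).re ≤ c * ‖x‖ ^ 2)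
    (hcomm : Commute B C) {t : ℝ} (ht : 0 ≤ t) (x : X) :
    ‖expOp B t x - expOp C t x‖ ≤ t * Real.exp (c * t) * ‖B x - C x‖ := by
  have hBC : ∀ s y, B (expOp C s y) = expOp C s (B y) := fun s y =>
    congrArg (fun L => L y) ((hcomm.smul_right s).exp_right).eq
  have hCC : ∀ s y, C (expOp C s y) = expOp C s (C y) := fun s y =>
    congrArg (fun L => L y) (((Commute.refl C).smul_right s).exp_right).eq
  have hd : ∀ s, HasDerivAt (fun s => expOp B s (expOp C (t - s) x))
      (expOp B s (expOp C (t - s) (B x - C x))) s := by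
    intro s
    have h1 : HasDerivAt (fun s => ((expOp B s).restrictScalars ℝ : X →L[ℝ] X))
        ((expOp B s * B).restrictScalars ℝ) s :=
      (ContinuousLinearMap.restrictScalarsL ℂ X X ℝ ℝ).hasFDerivAt.comp_hasDerivAt s
        (hasDerivAt_exp_smul_const (𝕂 := ℝ) B s)
    have h2 : HasDerivAt (fun s => expOp C (t - s) x) (-(expOp C (t - s) (C x))) s := by
      refine ((hasDerivAt_expOp_apply C x (t - s)).scomp s
        ((hasDerivAt_id s).const_sub t)).congr_deriv ?_
      simp
    refine (h1.clm_apply h2).congr_deriv ?_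
    simp [hBC, sub_eq_add_neg]
  have h := norm_image_sub_le_of_norm_deriv_le_segment' (f := fun s => expOp B s (expOp C (t - s) x))
    (C := Real.exp (c * t) * ‖B x - C x‖) (a := 0) (b := t)
    (fun s _ => (hd s).hasDerivWithinAt) ?_ t (Set.right_mem_Icc.2 ht)
  · simp only [sub_self, expOp_zero, sub_zero] at h
    simp only [ContinuousLinearMap.coe_id', id] at h
    linarith [h]
  · intro s hs
    calc ‖expOp B s (expOp C (t - s) (B x - C x))‖
        ≤ ‖expOp B s‖ * (‖expOp C (t - s)‖ * ‖B x - C x‖) :=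
          (ContinuousLinearMap.le_opNorm _ _).trans
            (by gcongr; exact ContinuousLinearMap.le_opNorm _ _)
      _ ≤ Real.exp (c * s) * (Real.exp (c * (t - s)) * ‖B x - C x‖) := by
          gcongr
          · exact norm_expOp_le hB hs.1
          · exact norm_expOp_le hC (sub_nonneg.2 hs.2.le)
      _ = _ := by
          rw [← mul_assoc, ← Real.exp_add]
          ring_nf

theorem norm_expOp_sub_self_le {B : X →L[ℂ] X} {c : ℝ} (hc : 0 ≤ c)
    (hB : ∀ x, (inner ℂ x (B x)).re ≤ c * ‖x‖ ^ 2) {t : ℝ} (ht : 0 ≤ t) (x : X) :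
    ‖expOp B t x - x‖ ≤ t * Real.exp (c * t) * ‖B x‖ := by
  have h := norm_expOp_sub_expOp_le (C := 0) hB (fun x => by simp; positivity)
    (Commute.zero_right B) ht x
  simpa [expOp] using h

/-- Pointwise limits of equibounded operators exist as soon as they exist on a dense set. -/
theorem exists_forall_tendsto_of_dense {B : ℕ → X →L[ℂ] X} {M : ℝ} (hM : ∀ n, ‖B n‖ ≤ M)
    {D : Set X} (hD : Dense D) (h : ∀ x ∈ D, CauchySeq fun n => B n x) :
    ∃ L : X →L[ℂ] X, ∀ x, Tendsto (fun n => B n x) atTop (𝓝 (L x)) := by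
  have hM0 : 0 ≤ M := (norm_nonneg _).trans (hM 0)
  have hc : ∀ x, CauchySeq fun n => B n x := by
    intro x
    rw [Metric.cauchySeq_iff]
    intro ε hε
    obtain ⟨y, hy, hyD⟩ := Metric.dense_iff.1 hD x (ε / (4 * (M + 1))) (by positivity)
    obtain ⟨N, hN⟩ := Metric.cauchySeq_iff.1 (h y hyD) (ε / 2) (by positivity)
    refine ⟨N, fun m hm n hn => ?_⟩
    have h1 : ∀ k, ‖B k (x - y)‖ ≤ ε / 4 := by
      intro k
      have h2 : ‖x - y‖ ≤ ε / (4 * (M + 1)) := by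
        rw [← dist_eq_norm, dist_comm]
        exact (Metric.mem_ball.1 hy).le
      calc ‖B k (x - y)‖ ≤ ‖B k‖ * ‖x - y‖ := ContinuousLinearMap.le_opNorm _ _
        _ ≤ (M + 1) * (ε / (4 * (M + 1))) := by gcongr; linarith [hM k]
        _ = ε / 4 := by field_simp
    have h3 := hN m hm n hn
    rw [dist_eq_norm] at h3 ⊢
    have h4 : B m x - B n x = B m (x - y) + (B m y - B n y) - B n (x - y) := by
      simp only [map_sub]; abel
    rw [h4]
    calc _ ≤ ‖B m (x - y)‖ + ‖B m y - B n y‖ + ‖B n (x - y)‖ :=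
          (norm_sub_le _ _).trans (by gcongr; exact norm_add_le _ _)
      _ < ε := by linarith [h1 m, h1 n]
  choose f hf using fun x => cauchySeq_tendsto_of_complete (hc x)
  exact ⟨continuousLinearMapOfTendsto B (tendsto_pi_nhds.2 hf), hf⟩

/-- Commuting bounded operators with a common growth bound that
converge to `A` on a dense domain give rise to a semigroup with derivative `A` on that domain. -/
theorem exists_semigroup_of_tendsto {A : X →ₗ.[ℂ] X} (hd : Dense (A.domain : Set X)) {c : ℝ}
    (hc : 0 ≤ c) {B : ℕ → X →L[ℂ] X} (hB : ∀ n x, (inner ℂ x (B n x)).re ≤ c * ‖x‖ ^ 2)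
    (hcomm : ∀ m n, Commute (B m) (B n))
    (hlim : ∀ x : A.domain, Tendsto (fun n => B n x) atTop (𝓝 (A x))) :
    ∃ T : ℝ≥0 → X →L[ℂ] X, IsC0Semigroup T ∧ (∀ t, ‖T t‖ ≤ Real.exp (c * t)) ∧
      ∀ x : A.domain, Tendsto (fun h : ℝ≥0 => ((h : ℝ) : ℂ)⁻¹ • (T h x - x)) (𝓝[>] 0)
        (𝓝 (A x)) := by
  have hex : ∀ t : ℝ≥0, ∃ L : X →L[ℂ] X, ∀ x, Tendsto (fun n => expOp (B n) t x) atTop (𝓝 (L x)) := by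
    intro t
    refine exists_forall_tendsto_of_dense (fun n => norm_expOp_le (hB n) t.2) hd fun x hx => ?_
    have h := (hlim ⟨x, hx⟩).cauchySeq
    rw [Metric.cauchySeq_iff] at h ⊢
    intro ε hε
    obtain ⟨N, hN⟩ := h (ε / (t * Real.exp (c * t) + 1)) (by positivity)
    refine ⟨N, fun m hm n hn => ?_⟩
    have h1 := hN m hm n hn
    rw [dist_eq_norm] at h1 ⊢
    calc _ ≤ t * Real.exp (c * t) * ‖B m x - B n x‖ :=
          norm_expOp_sub_expOp_le (hB m) (hB n) (hcomm m n) t.2 x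
      _ ≤ (t * Real.exp (c * t) + 1) * ‖B m x - B n x‖ := by gcongr; linarith
      _ < (t * Real.exp (c * t) + 1) * (ε / (t * Real.exp (c * t) + 1)) := by gcongr
      _ = ε := by field_simp
  choose T hT using hex
  have hnorm : ∀ t, ‖T t‖ ≤ Real.exp (c * t) := fun t =>
    ContinuousLinearMap.opNorm_le_bound _ (Real.exp_pos _).le fun x =>
      le_of_tendsto (hT t x).norm (Eventually.of_forall fun n =>
        ((expOp (B n) t).le_opNorm x).trans (by gcongr; exact norm_expOp_le (hB n) t.2))
  have hsub : ∀ (t : ℝ≥0) (x : A.domain), ‖T t x - x‖ ≤ t * Real.exp (c * t) * ‖A x‖ := fun t x =>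
    le_of_tendsto_of_tendsto ((hT t x).sub_const _).norm ((hlim x).norm.const_mul _)
      (Eventually.of_forall fun n => norm_expOp_sub_self_le hc (hB n) t.2 x)
  have hexp0 : Tendsto (fun t : ℝ≥0 => Real.exp (c * t)) (𝓝 0) (𝓝 1) := by
    have : Continuous fun t : ℝ≥0 => Real.exp (c * t) := by fun_prop
    simpa using this.tendsto 0
  have htexp0 : Tendsto (fun t : ℝ≥0 => (t : ℝ) * Real.exp (c * t)) (𝓝 0) (𝓝 0) := by
    have : Continuous fun t : ℝ≥0 => (t : ℝ) * Real.exp (c * t) := by fun_prop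
    simpa using this.tendsto 0
  refine ⟨T, ⟨?_, ?_, ?_⟩, hnorm, ?_⟩
  · ext x
    refine tendsto_nhds_unique (hT 0 x) ?_
    simp [expOp_zero]
  · intro s t
    ext x
    refine tendsto_nhds_unique (hT (s + t) x) ?_
    -- The limit of a product of strongly convergent operators needs the bound `e^{cs}`, uniform in
    -- `n`.
    have h1 : Tendsto (fun n => expOp (B n) s (expOp (B n) t x - T t x)) atTop (𝓝 0) := by
      refine squeeze_zero_norm (a := fun n => Real.exp (c * s) * ‖expOp (B n) t x - T t x‖)
        (fun n => ((expOp (B n) s).le_opNorm _).trans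
          (by gcongr; exact norm_expOp_le (hB n) s.2)) ?_
      simpa using ((hT t x).sub_const (T t x)).norm.const_mul (Real.exp (c * s))
    have h2 := h1.add (hT s (T t x))
    rw [zero_add] at h2
    refine h2.congr fun n => ?_
    rw [NNReal.coe_add, expOp_add]
    simp
  · intro x
    rw [tendsto_iff_norm_sub_tendsto_zero]
    rw [Metric.tendsto_nhds]
    intro ε hε
    obtain ⟨y, hy, hyD⟩ := Metric.dense_iff.1 hd x (ε / 8) (by positivity)
    have e1 : ∀ᶠ t : ℝ≥0 in 𝓝 0, Real.exp (c * t) < 2 := hexp0.eventually_lt_const (by norm_num)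
    have e2 : ∀ᶠ t : ℝ≥0 in 𝓝 0, (t : ℝ) * Real.exp (c * t) * ‖A ⟨y, hyD⟩‖ < ε / 8 :=
      (by simpa using htexp0.mul_const ‖A ⟨y, hyD⟩‖ :
        Tendsto _ _ (𝓝 (0 : ℝ))).eventually_lt_const (by positivity)
    filter_upwards [e1, e2] with t h1 h2
    have hxy : ‖x - y‖ < ε / 8 := by
      rw [← dist_eq_norm, dist_comm]; exact Metric.mem_ball.1 hy
    have h3 : T t x - x = T t (x - y) + (T t y - y) - (x - y) := by simp only [map_sub]; abel
    have h4 : ‖T t (x - y)‖ ≤ 2 * ‖x - y‖ :=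
      ((T t).le_opNorm _).trans (by gcongr; exact (hnorm t).trans h1.le)
    have h5 := hsub t ⟨y, hyD⟩
    rw [Real.dist_eq, sub_zero, abs_norm, h3]
    calc _ ≤ ‖T t (x - y)‖ + ‖T t y - y‖ + ‖x - y‖ :=
          (norm_sub_le _ _).trans (by gcongr; exact norm_add_le _ _)
      _ < ε := by dsimp only at h5; linarith
  · intro x
    -- the difference quotient is compared with `A x` through a nearby element of the domain
    have hquot : ∀ (h : ℝ≥0) (z : A.domain), ‖T h x - x - ((h : ℝ) : ℂ) • A x‖ ≤
        h * ((Real.exp (c * h) + 1) * ‖A x - z‖ + h * Real.exp (c * h) * ‖A z‖) := by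
      intro h z
      refine le_of_tendsto_of_tendsto (b := atTop)
        (f := fun n => ‖expOp (B n) h x - x - ((h : ℝ) : ℂ) • B n x‖)
        (g := fun n => h * ((Real.exp (c * h) + 1) * ‖B n x - z‖ +
          h * Real.exp (c * h) * ‖B n z‖)) ?_ ?_ (Eventually.of_forall fun n => ?_)
      · exact (((hT h x).sub_const _).sub ((hlim x).const_smul _)).norm
      · exact ((((hlim x).sub_const _).norm.const_mul _).add ((hlim z).norm.const_mul _)).const_mul _
      · have hb : ∀ s ∈ Set.Ico (0 : ℝ) h, ‖expOp (B n) s (B n x) - B n x‖ ≤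
            (Real.exp (c * h) + 1) * ‖B n x - z‖ + h * Real.exp (c * h) * ‖B n z‖ := by
          intro s hs
          have hexps : Real.exp (c * s) ≤ Real.exp (c * h) :=
            Real.exp_le_exp.2 (mul_le_mul_of_nonneg_left hs.2.le hc)
          have h3 : expOp (B n) s (B n x) - B n x =
              expOp (B n) s (B n x - z) + (expOp (B n) s z - z) - (B n x - z) := by
            simp only [map_sub]; abel
          have h4 : ‖expOp (B n) s (B n x - z)‖ ≤ Real.exp (c * h) * ‖B n x - z‖ :=
            ((expOp (B n) s).le_opNorm _).trans
              (by gcongr; exact (norm_expOp_le (hB n) hs.1).trans hexps)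
          have h5 := norm_expOp_sub_self_le hc (hB n) hs.1 z
          have h6 : s * Real.exp (c * s) * ‖B n z‖ ≤ h * Real.exp (c * h) * ‖B n z‖ := by
            gcongr
            exact hs.2.le
          rw [h3]
          calc _ ≤ ‖expOp (B n) s (B n x - z)‖ + ‖expOp (B n) s z - z‖ + ‖B n x - z‖ :=
                (norm_sub_le _ _).trans (by gcongr; exact norm_add_le _ _)
            _ ≤ _ := by linarith
        have hd : ∀ s, HasDerivAt (fun s => expOp (B n) s x - s • B n x)
            (expOp (B n) s (B n x) - B n x) s := fun s => by
          refine ((hasDerivAt_expOp_apply (B n) x s).sub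
            ((hasDerivAt_id s).smul_const (B n (x : X)))).congr_deriv ?_
          simp
        have h7 := norm_image_sub_le_of_norm_deriv_le_segment'
          (fun s _ => (hd s).hasDerivWithinAt) hb h (Set.right_mem_Icc.2 h.2)
        have h8 : expOp (B n) h x - x - ((h : ℝ) : ℂ) • B n x =
            expOp (B n) h x - (h : ℝ) • B n x - (expOp (B n) 0 x - (0 : ℝ) • B n x) := by
          rw [expOp_zero, Complex.coe_smul]
          simp only [ContinuousLinearMap.coe_id', id, zero_smul, sub_zero]
          abel
        dsimp only
        rw [h8]
        linarith
    rw [tendsto_iff_norm_sub_tendsto_zero, Metric.tendsto_nhds]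
    intro ε hε
    obtain ⟨z, hz, hzD⟩ := Metric.dense_iff.1 hd (A x) (ε / 8) (by positivity)
    have e1 : ∀ᶠ t : ℝ≥0 in 𝓝[>] 0, Real.exp (c * t) < 2 :=
      (hexp0.mono_left nhdsWithin_le_nhds).eventually_lt_const (by norm_num)
    have e2 : ∀ᶠ t : ℝ≥0 in 𝓝[>] 0, (t : ℝ) * Real.exp (c * t) * ‖A ⟨z, hzD⟩‖ < ε / 8 :=
      ((by simpa using htexp0.mul_const ‖A ⟨z, hzD⟩‖ :
        Tendsto _ _ (𝓝 (0 : ℝ))).mono_left nhdsWithin_le_nhds).eventually_lt_const (by positivity)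
    filter_upwards [e1, e2, self_mem_nhdsWithin] with h h1 h2 hpos
    have hpos' : (0 : ℝ) < h := hpos
    have hne : ((h : ℝ) : ℂ) ≠ 0 := by exact_mod_cast hpos'.ne'
    have hxz : ‖A x - z‖ < ε / 8 := by
      rw [← dist_eq_norm, dist_comm]; exact Metric.mem_ball.1 hz
    have h3 : ((h : ℝ) : ℂ)⁻¹ • (T h x - x) - A x =
        ((h : ℝ) : ℂ)⁻¹ • (T h x - x - ((h : ℝ) : ℂ) • A x) := by
      rw [smul_sub _ (T h x - x), smul_smul, inv_mul_cancel₀ hne, one_smul]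
    rw [Real.dist_eq, sub_zero, abs_norm, h3, norm_smul, norm_inv, Complex.norm_real,
      Real.norm_of_nonneg hpos'.le, inv_mul_lt_iff₀ hpos']
    refine (hquot h ⟨z, hzD⟩).trans_lt ?_
    have h4 : (Real.exp (c * h) + 1) * ‖A x - z‖ ≤ 3 * ‖A x - z‖ := by gcongr; linarith
    gcongr
    dsimp only
    linarith

end AbstractSemigroup

/-! ### Resolvents, Yosida approximation and generation -/

section LumerPhillips

variable {X : Type*} [NormedAddCommGroup X] [InnerProductSpace ℂ X]

theorem resolvent_estimate {A : X →ₗ.[ℂ] X} {c : ℝ}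
    (hdiss : ∀ x : A.domain, (inner ℂ (x : X) (A x)).re ≤ c * ‖(x : X)‖ ^ 2) (l : ℝ)
    (x : A.domain) : (l - c) * ‖(x : X)‖ ≤ ‖(l : ℂ) • (x : X) - A x‖ := by
  rcases eq_or_ne ‖(x : X)‖ 0 with h0 | h0
  · rw [h0, mul_zero]; exact norm_nonneg _
  have hpos : 0 < ‖(x : X)‖ := lt_of_le_of_ne (norm_nonneg _) (Ne.symm h0)
  have h1 : (inner ℂ (x : X) ((l : ℂ) • (x : X) - A x)).re =
      l * ‖(x : X)‖ ^ 2 - (inner ℂ (x : X) (A x)).re := by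
    rw [inner_sub_right, inner_smul_right, inner_self_eq_norm_sq_to_K, Complex.sub_re]
    simp only [Complex.coe_algebraMap, ← Complex.ofReal_pow, Complex.re_ofReal_mul,
      Complex.ofReal_re]
  have h2 : (inner ℂ (x : X) ((l : ℂ) • (x : X) - A x)).re ≤
      ‖(x : X)‖ * ‖(l : ℂ) • (x : X) - A x‖ :=
    (Complex.re_le_norm _).trans (norm_inner_le_norm _ _)
  have h3 := hdiss x
  refine le_of_mul_le_mul_left ?_ hpos
  nlinarith

/-- The resolvent of a dissipative operator at a point where it is surjective. -/
theorem exists_resolvent {A : X →ₗ.[ℂ] X} {c : ℝ}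
    (hdiss : ∀ x : A.domain, (inner ℂ (x : X) (A x)).re ≤ c * ‖(x : X)‖ ^ 2) {l : ℝ} (hl : c < l)
    (hsurj : ∀ y, ∃ x : A.domain, (l : ℂ) • (x : X) - A x = y) :
    ∃ R : X →L[ℂ] X, (∀ y, ∃ h : R y ∈ A.domain, (l : ℂ) • R y - A ⟨R y, h⟩ = y) ∧
      (∀ x : A.domain, R ((l : ℂ) • (x : X) - A x) = x) ∧ ∀ y, (l - c) * ‖R y‖ ≤ ‖y‖ := by
  have hinj : ∀ x x' : A.domain, (l : ℂ) • (x : X) - A x = (l : ℂ) • (x' : X) - A x' → x = x' := by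
    intro x x' h
    have h1 := resolvent_estimate hdiss l (x - x')
    have h2 : (l : ℂ) • ((x - x' : A.domain) : X) - A (x - x') = 0 := by
      rw [A.map_sub, Submodule.coe_sub, smul_sub, sub_sub_sub_comm, h, sub_self]
    rw [h2, norm_zero] at h1
    have h3 : ‖((x - x' : A.domain) : X)‖ = 0 :=
      le_antisymm (nonpos_of_mul_nonpos_right h1 (sub_pos.2 hl)) (norm_nonneg _)
    exact sub_eq_zero.1 (Subtype.ext (norm_eq_zero.1 h3))
  choose r hr using hsurj
  have hr' : ∀ x : A.domain, r ((l : ℂ) • (x : X) - A x) = x := fun x => hinj _ _ (hr _)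
  have hbound : ∀ y, (l - c) * ‖(r y : X)‖ ≤ ‖y‖ := fun y => by
    simpa only [hr] using resolvent_estimate hdiss l (r y)
  let R₀ : X →ₗ[ℂ] X :=
    { toFun := fun y => r y
      map_add' := fun y z => by
        rw [← Submodule.coe_add]
        congr 1
        refine hinj _ _ ?_
        rw [hr, A.map_add, Submodule.coe_add, smul_add, add_sub_add_comm, hr, hr]
      map_smul' := fun k y => by
        rw [RingHom.id_apply, ← Submodule.coe_smul]
        congr 1
        refine hinj _ _ ?_
        rw [hr, A.map_smul, Submodule.coe_smul, smul_comm, ← smul_sub, hr] }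
  refine ⟨R₀.mkContinuous (l - c)⁻¹ fun y => ?_, fun y => ⟨(r y).2, hr y⟩, fun x => ?_, hbound⟩
  · rw [← div_eq_inv_mul, le_div_iff₀' (sub_pos.2 hl)]
    exact hbound y
  · exact congrArg Subtype.val (hr' x)

variable [CompleteSpace X]

/-- The Lumer–Phillips theorem in a Hilbert space. -/
theorem exists_generates_of_dissipative {A : X →ₗ.[ℂ] X} (hd : Dense (A.domain : Set X)) {c : ℝ}
    (hc : 0 ≤ c) (hdiss : ∀ x : A.domain, (inner ℂ (x : X) (A x)).re ≤ c * ‖(x : X)‖ ^ 2) {l₀ : ℝ}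
    (hsurj : ∀ l : ℝ, l₀ ≤ l → ∀ y, ∃ x : A.domain, (l : ℂ) • (x : X) - A x = y) :
    ∃ T : ℝ≥0 → X →L[ℂ] X, Generates A T := by
  -- The shift ensures `l n ≥ l₀`, for surjectivity, and `l n ≥ 6c + 1`. The latter gives `‖l R‖ ≤
  -- 2` and leaves `l 0 > 4c` for the uniqueness argument at the end.
  obtain ⟨N, hN⟩ := exists_nat_ge (l₀ + 6 * c + |l₀| + 1)
  let l : ℕ → ℝ := fun n => n + N
  have hl₀ : ∀ n, l₀ ≤ l n := fun n => by
    have := abs_nonneg l₀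
    have : (0 : ℝ) ≤ n := n.cast_nonneg
    simp only [l]; linarith
  have hl : ∀ n, 6 * c + 1 ≤ l n := fun n => by
    have := neg_abs_le l₀
    have : (0 : ℝ) ≤ n := n.cast_nonneg
    simp only [l]; linarith
  have hlpos : ∀ n, 0 < l n := fun n => by linarith [hl n]
  have hltop : Tendsto l atTop atTop :=
    tendsto_atTop_add_const_right _ _ tendsto_natCast_atTop_atTop
  choose R hR hR' hRn using fun n =>
    exists_resolvent hdiss (by linarith [hl n] : c < l n) (hsurj (l n) (hl₀ n))
  have hRn2 : ∀ n y, l n * ‖R n y‖ ≤ 2 * ‖y‖ := fun n y => by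
    have h1 := hRn n y
    have h2 : l n ≤ 2 * (l n - c) := by linarith [hl n]
    have := mul_le_mul_of_nonneg_right h2 (norm_nonneg (R n y))
    linarith
  have hRA : ∀ n (x : A.domain), R n (A x) = (l n : ℂ) • R n x - x := fun n x => by
    have h := hR' n x
    rw [map_sub, map_smul, sub_eq_iff_eq_add] at h
    rw [eq_sub_iff_add_eq, add_comm, h]
  -- The Yosida approximations of `A`, equal to `l R A` on the domain.
  let B : ℕ → X →L[ℂ] X := fun n => (l n : ℂ) • ((l n : ℂ) • R n - 1)
  have hB : ∀ n y, B n y = (l n : ℂ) • ((l n : ℂ) • R n y - y) := fun n y => rfl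
  have hBA : ∀ n (x : A.domain), B n x = (l n : ℂ) • R n (A x) := fun n x => by rw [hB, hRA]
  -- With `z = R x` one has `x = l z - A z` and `B x = l A z`; the term `-l ‖Az‖²` is dropped. The
  -- factor 4 is the square of the bound 2 on `‖l R‖`. This loss is harmless here: the sharp rate is
  -- recovered in `Generates.norm_le`.
  have hBdiss : ∀ n x, (inner ℂ x (B n x)).re ≤ 4 * c * ‖x‖ ^ 2 := by
    intro n x
    obtain ⟨hm, hx⟩ := hR n x
    have h4 : (l n * ‖R n x‖) ^ 2 ≤ (2 * ‖x‖) ^ 2 := by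
      have := hRn2 n x
      have := hlpos n
      gcongr
    have h1 : B n x = (l n : ℂ) • A ⟨R n x, hm⟩ := by
      rw [hB]; congr 1
      rw [sub_eq_iff_eq_add] at hx ⊢
      rw [hx, add_comm]
    rw [h1]
    clear h1
    generalize R n x = z at hm hx h4
    have h2 : (inner ℂ x ((l n : ℂ) • A ⟨z, hm⟩)).re =
        l n * (l n * (inner ℂ z (A ⟨z, hm⟩)).re - ‖A ⟨z, hm⟩‖ ^ 2) := by
      rw [inner_smul_right]
      nth_rewrite 1 [← hx]
      rw [inner_sub_left, inner_smul_left, inner_self_eq_norm_sq_to_K, Complex.conj_ofReal]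
      simp only [Complex.coe_algebraMap, ← Complex.ofReal_pow, Complex.re_ofReal_mul,
        Complex.sub_re, Complex.ofReal_re]
    have h3 := hdiss ⟨z, hm⟩
    have h5 := hlpos n
    rw [h2]
    calc _ ≤ l n * (l n * (inner ℂ z (A ⟨z, hm⟩)).re) := by
          gcongr; linarith [sq_nonneg ‖A ⟨z, hm⟩‖]
      _ ≤ l n * (l n * (c * ‖z‖ ^ 2)) := by gcongr
      _ = c * (l n * ‖z‖) ^ 2 := by ring
      _ ≤ c * (2 * ‖x‖) ^ 2 := by gcongr
      _ = _ := by ring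
  have hRcomm : ∀ m n, Commute (R m) (R n) := by
    -- The resolvent identity; exchanging `m` and `n` gives commutation.
    have key : ∀ m n y, ((l n - l m : ℝ) : ℂ) • R m (R n y) = R m y - R n y := by
      intro m n y
      obtain ⟨hmem, hy⟩ := hR n y
      have h1 := hR' m ⟨R n y, hmem⟩
      have h2 : y = ((l m : ℂ) • R n y - A ⟨R n y, hmem⟩) + ((l n - l m : ℝ) : ℂ) • R n y := by
        conv_lhs => rw [← hy]
        push_cast
        rw [sub_smul]; abel
      conv_rhs => rw [h2, map_add, map_smul, h1, ← h2]
      simp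
    intro m n
    rcases eq_or_ne (l n) (l m) with h | h
    · have : m = n := by
        have : (m : ℝ) = n := by simp only [l] at h; linarith
        exact_mod_cast this
      rw [this]
    · ext y
      have hne : ((l n - l m : ℝ) : ℂ) ≠ 0 := by exact_mod_cast sub_ne_zero.2 h
      refine smul_right_injective X hne ?_
      change ((l n - l m : ℝ) : ℂ) • R m (R n y) = ((l n - l m : ℝ) : ℂ) • R n (R m y)
      have h1 := key n m y
      have h2 : ((l n - l m : ℝ) : ℂ) = -((l m - l n : ℝ) : ℂ) := by push_cast; ring
      rw [key m n y, h2, neg_smul, h1, neg_sub]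
  have hcomm : ∀ m n, Commute (B m) (B n) := fun m n =>
    (((((hRcomm m n).smul_left _).smul_right _).sub_left (Commute.one_left _)).sub_right
      ((Commute.one_right _))).smul_left _ |>.smul_right _
  -- On the domain `l R z - z = R A z = O(1/l)`; density and `‖l R‖ ≤ 2` cover the other vectors.
  have hlim₀ : ∀ y, Tendsto (fun n => (l n : ℂ) • R n y) atTop (𝓝 y) := by
    intro y
    rw [tendsto_iff_norm_sub_tendsto_zero, Metric.tendsto_nhds]
    intro ε hε
    obtain ⟨z, hz, hzD⟩ := Metric.dense_iff.1 hd y (ε / 6) (by positivity)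
    have h0 : Tendsto (fun n => (l n)⁻¹ * (2 * ‖A ⟨z, hzD⟩‖)) atTop (𝓝 0) := by
      simpa using (tendsto_inv_atTop_zero.comp hltop).mul_const (2 * ‖A ⟨z, hzD⟩‖)
    filter_upwards [h0.eventually_lt_const (by positivity : 0 < ε / 3)] with n hn
    have h1 : (l n : ℂ) • R n y - y = (l n : ℂ) • R n (y - z) + R n (A ⟨z, hzD⟩) - (y - z) := by
      rw [hRA, map_sub, smul_sub]; abel
    have hyz : ‖y - z‖ < ε / 6 := by
      rw [← dist_eq_norm, dist_comm]; exact Metric.mem_ball.1 hz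
    have h2 : ‖(l n : ℂ) • R n (y - z)‖ ≤ 2 * ‖y - z‖ := by
      rw [norm_smul, Complex.norm_real, Real.norm_of_nonneg (hlpos n).le]
      exact hRn2 n _
    have h3 : ‖R n (A ⟨z, hzD⟩)‖ ≤ (l n)⁻¹ * (2 * ‖A ⟨z, hzD⟩‖) := by
      rw [← div_eq_inv_mul, le_div_iff₀' (hlpos n)]
      exact hRn2 n _
    rw [Real.dist_eq, sub_zero, abs_norm, h1]
    calc _ ≤ ‖(l n : ℂ) • R n (y - z)‖ + ‖R n (A ⟨z, hzD⟩)‖ + ‖y - z‖ :=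
          (norm_sub_le _ _).trans (by gcongr; exact norm_add_le _ _)
      _ < ε := by linarith
  have hlim : ∀ x : A.domain, Tendsto (fun n => B n x) atTop (𝓝 (A x)) := fun x =>
    (hlim₀ (A x)).congr fun n => (hBA n x).symm
  obtain ⟨T, hT, hTn, hTA⟩ := exists_semigroup_of_tendsto hd (by positivity) hBdiss hcomm hlim
  refine ⟨T, hT, fun x y => ⟨?_, fun h => ?_⟩⟩
  · intro h
    obtain ⟨z, hz⟩ := A.mem_graph_iff'.1 h
    cases hz
    exact hTA z
  · -- the generator of `T` extends `A` and is dissipative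
    have hl0 := hl 0
    -- By this choice `x - z` is an eigenvector of the generator with eigenvalue `l 0`, or zero. The
    -- growth rate `4c < l 0` excludes the former.
    obtain ⟨z, hz⟩ := hsurj (l 0) (hl₀ 0) ((l 0 : ℂ) • x - y)
    have h1 : Tendsto (fun h : ℝ≥0 => ((h : ℝ) : ℂ)⁻¹ • (T h (x - z) - (x - z))) (𝓝[>] 0)
        (𝓝 (y - A z)) := (h.sub (hTA z)).congr fun h => by
      rw [← smul_sub, map_sub]; congr 1; abel
    have h2 : y - A z = (l 0 : ℂ) • (x - z) := by
      linear_combination (norm := module) hz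
    have h3 : (inner ℂ (x - z) (y - A z)).re ≤ 4 * c * ‖x - z‖ ^ 2 := by
      have hexp : Tendsto (fun h : ℝ≥0 => (h : ℝ)⁻¹ * (Real.exp (4 * c * h) - 1) * ‖x - z‖ ^ 2)
          (𝓝[>] 0) (𝓝 (4 * c * ‖x - z‖ ^ 2)) := by
        refine Tendsto.mul_const _ ?_
        have hder : HasDerivAt (fun s : ℝ => Real.exp (4 * c * s)) (4 * c) 0 := by
          simpa using ((hasDerivAt_id (0 : ℝ)).const_mul (4 * c)).exp
        have h5 := hasDerivAt_iff_tendsto_slope_zero.1 hder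
        have h6 : Tendsto (fun h : ℝ≥0 => (h : ℝ)) (𝓝[>] 0) (𝓝[≠] 0) := by
          refine tendsto_nhdsWithin_iff.2 ⟨?_, ?_⟩
          · exact (NNReal.continuous_coe.tendsto 0).mono_left nhdsWithin_le_nhds
          · filter_upwards [self_mem_nhdsWithin] with h hh
            exact (NNReal.coe_pos.2 hh).ne'
        refine (h5.comp h6).congr fun h => ?_
        simp
      refine le_of_tendsto_of_tendsto
        ((Complex.continuous_re.tendsto _).comp (tendsto_const_nhds.inner h1)) hexp ?_
      filter_upwards [self_mem_nhdsWithin] with h hh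
      have hh' : (0 : ℝ) < h := hh
      have h7 : (inner ℂ (x - z) (T h (x - z))).re ≤ Real.exp (4 * c * h) * ‖x - z‖ ^ 2 :=
        (Complex.re_le_norm _).trans ((norm_inner_le_norm _ _).trans (by
          have := (T h).le_of_opNorm_le (hTn h) (x - z)
          nlinarith [norm_nonneg (x - z)]))
      simp only [Function.comp_apply]
      rw [inner_smul_right, inner_sub_right, ← Complex.ofReal_inv, Complex.re_ofReal_mul,
        Complex.sub_re, mul_assoc]
      have h8 : (inner ℂ (x - z) (x - z) : ℂ).re = ‖x - z‖ ^ 2 := by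
        rw [inner_self_eq_norm_sq_to_K]; norm_cast
      rw [h8]
      gcongr
      linarith
    have h4 : ‖x - z‖ ^ 2 ≤ 0 := by
      rw [h2, inner_smul_right, inner_self_eq_norm_sq_to_K] at h3
      have h9 : ((l 0 : ℂ) * ((‖x - (z : X)‖ : ℝ) : ℂ) ^ 2).re = l 0 * ‖x - (z : X)‖ ^ 2 := by
        norm_cast
      have h10 : l 0 * ‖x - (z : X)‖ ^ 2 ≤ 4 * c * ‖x - (z : X)‖ ^ 2 := h9 ▸ h3
      nlinarith [sq_nonneg ‖x - (z : X)‖]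
    have h5 : x - z = 0 := norm_eq_zero.1 (pow_eq_zero_iff two_ne_zero |>.1
      (le_antisymm h4 (sq_nonneg _)))
    rw [h5, smul_zero, sub_eq_zero] at h2
    exact A.mem_graph_iff.2 ⟨z, (sub_eq_zero.1 h5).symm, h2.symm⟩

end LumerPhillips

/-! ### Strong continuity and the sharp growth bound -/

section GrowthBound

variable {X : Type*} [NormedAddCommGroup X] [InnerProductSpace ℂ X] [CompleteSpace X]

/-- Otherwise the norms blow up along some `tₙ → 0`, while every orbit `T tₙ x` converges; this
contradicts uniform boundedness. -/
theorem IsC0Semigroup.exists_norm_le {T : ℝ≥0 → X →L[ℂ] X} (hT : IsC0Semigroup T) :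
    ∃ δ > 0, ∃ M : ℝ, ∀ t ≤ δ, ‖T t‖ ≤ M := by
  by_contra! hcon
  have h : ∀ n : ℕ, ∃ t : ℝ≥0, t ≤ 1 / ((n : ℝ≥0) + 1) ∧ (n : ℝ) < ‖T t‖ := fun n =>
    hcon _ (by positivity) n
  choose t ht hTn using h
  have ht0 : Tendsto t atTop (𝓝 0) :=
    tendsto_of_tendsto_of_tendsto_of_le_of_le tendsto_const_nhds
      (tendsto_one_div_add_atTop_nhds_zero_nat (𝕜 := ℝ≥0)) (fun _ => zero_le) ht
  obtain ⟨C, hC⟩ := banach_steinhaus (g := fun n => T (t n)) fun x => by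
    obtain ⟨C, hC⟩ := ((hT.tendsto_zero x).comp ht0).norm.bddAbove_range
    exact ⟨C, fun n => hC ⟨n, rfl⟩⟩
  obtain ⟨n, hn⟩ := exists_nat_gt C
  linarith [hC n, hTn n]

theorem IsC0Semigroup.continuous {T : ℝ≥0 → X →L[ℂ] X} (hT : IsC0Semigroup T) (x : X) :
    Continuous fun t => T t x := by
  obtain ⟨δ, hδ, M, hM⟩ := hT.exists_norm_le
  have hM0 : 0 ≤ M := (norm_nonneg _).trans (hM 0 hδ.le)
  rw [continuous_iff_continuousAt]
  intro t
  -- factor out the semigroup at a time `s` slightly before `t`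
  set s := t - δ / 2 with hs
  have hts : t - s ≤ δ / 2 := by
    rw [hs, tsub_le_iff_left]; exact le_tsub_add
  have hev : ∀ᶠ r in 𝓝 t, s ≤ r ∧ r - s ≤ δ := by
    have h2 : ∀ᶠ r in 𝓝 t, r < t + δ / 2 := gt_mem_nhds (lt_add_of_pos_right _ (by positivity))
    have h1 : ∀ᶠ r in 𝓝 t, s ≤ r := by
      rcases eq_or_ne t 0 with rfl | h0
      · refine Eventually.of_forall fun r => ?_
        simp [hs]
      · exact (lt_mem_nhds (tsub_lt_self (pos_iff_ne_zero.2 h0) (by positivity))).mono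
          fun r hr => hr.le
    filter_upwards [h1, h2] with r hr1 hr2
    refine ⟨hr1, tsub_le_iff_left.2 (hr2.le.trans ?_)⟩
    calc t + δ / 2 ≤ (s + δ / 2) + δ / 2 := by gcongr; exact le_tsub_add
      _ = s + δ := by rw [add_assoc, add_halves]
  set y := T s x
  have hbound : ∀ᶠ r in 𝓝 t, ‖T r x - T t x‖ ≤ M * ‖T (max r t - min r t) y - y‖ := by
    have key : ∀ a b : ℝ≥0, s ≤ a → a ≤ b → a - s ≤ δ →
        ‖T b x - T a x‖ ≤ M * ‖T (b - a) y - y‖ := by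
      intro a b hsa hab ha
      have h1 : T a x = T (a - s) y := by
        conv_lhs => rw [← tsub_add_cancel_of_le hsa, hT.map_add]
        rfl
      have h2 : T b x = T (a - s) (T (b - a) y) := by
        have h3 : b = (a - s) + ((b - a) + s) := by
          rw [add_comm (b - a) s, ← add_assoc, tsub_add_cancel_of_le hsa,
            add_tsub_cancel_of_le hab]
        conv_lhs => rw [h3, hT.map_add, hT.map_add]
        rfl
      rw [h1, h2, ← map_sub]
      exact (T (a - s)).le_of_opNorm_le (hM _ ha) _
    filter_upwards [hev] with r hr
    rcases le_total r t with h | h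
    · rw [max_eq_right h, min_eq_left h, norm_sub_rev]
      exact key r t hr.1 h hr.2
    · rw [max_eq_left h, min_eq_right h]
      exact key t r tsub_le_self h (hts.trans (half_le_self hδ.le))
  rw [ContinuousAt, tendsto_iff_norm_sub_tendsto_zero]
  refine squeeze_zero' (Eventually.of_forall fun _ => norm_nonneg _) hbound ?_
  have h0 : Tendsto (fun r : ℝ≥0 => max r t - min r t) (𝓝 t) (𝓝 0) := by
    have : Continuous fun r : ℝ≥0 => max r t - min r t := by fun_prop
    simpa using this.tendsto t
  have h1 := ((hT.tendsto_zero y).comp h0).sub_const y |>.norm.const_mul M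
  simpa using h1

/-- The growth bound of a semigroup whose generator is dissipative up to the shift `c`. -/
theorem Generates.norm_le {A : X →ₗ.[ℂ] X} {T : ℝ≥0 → X →L[ℂ] X} (hT : Generates A T)
    (hd : Dense (A.domain : Set X)) {c : ℝ}
    (hdiss : ∀ x : A.domain, (inner ℂ (x : X) (A x)).re ≤ c * ‖(x : X)‖ ^ 2) (t : ℝ≥0) :
    ‖T t‖ ≤ Real.exp (c * t) := by
  -- The orbit stays in the domain because the graph of `A` contains every limit of difference
  -- quotients. Hence the dissipativity estimate applies at each time.
  have hgen : ∀ (x : A.domain) (s : ℝ≥0), ∃ h : T s x ∈ A.domain, A ⟨T s x, h⟩ = T s (A x) ∧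
      Tendsto (fun h : ℝ≥0 => ((h : ℝ) : ℂ)⁻¹ • (T (s + h) x - T s x)) (𝓝[>] 0)
        (𝓝 (T s (A x))) := by
    intro x s
    have h1 := (hT.mem_graph_iff x (A x)).1 (A.mem_graph x)
    have h2 := ((T s).continuous.tendsto _).comp h1
    have h3 : Tendsto (fun h : ℝ≥0 => ((h : ℝ) : ℂ)⁻¹ • (T h (T s x) - T s x)) (𝓝[>] 0)
        (𝓝 (T s (A x))) := h2.congr fun h => by
      have e1 : T s (T h x) = T (s + h) x := by rw [hT.isC0Semigroup.map_add]; rfl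
      have e2 : T h (T s x) = T (h + s) x := by rw [hT.isC0Semigroup.map_add]; rfl
      simp only [Function.comp_apply, map_smul, map_sub]
      rw [e1, e2, add_comm]
    obtain ⟨z, hz, hAz⟩ := A.mem_graph_iff.1 ((hT.mem_graph_iff _ _).2 h3)
    dsimp only at hz hAz
    refine ⟨hz ▸ z.2, ?_, h3.congr fun h => ?_⟩
    · rw [← hAz]; congr 1; exact Subtype.ext hz.symm
    · rw [add_comm s h, hT.isC0Semigroup.map_add]; rfl
  have hdom : ∀ x : A.domain, ‖T t x‖ ≤ Real.exp (c * t) * ‖(x : X)‖ := by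
    intro x
    have h := norm_le_exp_of_re_inner_deriv_le (c := c) (T := t)
      (u := fun s : ℝ => T s.toNNReal x) (u' := fun s => T s.toNNReal (A x)) t.2
      ((hT.isC0Semigroup.continuous x).comp continuous_real_toNNReal).continuousOn ?_ ?_
    · simpa [hT.isC0Semigroup.map_zero] using h
    · intro s hs
      rw [hasDerivWithinAt_iff_tendsto_slope, Set.Ici_sdiff_left]
      obtain ⟨-, -, h1⟩ := hgen x s.toNNReal
      have h2 : Tendsto (fun r : ℝ => (r - s).toNNReal) (𝓝[>] s) (𝓝[>] 0) := by
        refine tendsto_nhdsWithin_iff.2 ⟨?_, ?_⟩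
        · have : Continuous fun r : ℝ => (r - s).toNNReal := by fun_prop
          simpa using (this.tendsto s).mono_left nhdsWithin_le_nhds
        · filter_upwards [self_mem_nhdsWithin] with r hr
          exact Real.toNNReal_pos.2 (sub_pos.2 hr)
      refine (h1.comp h2).congr' ?_
      filter_upwards [self_mem_nhdsWithin] with r hr
      have hr' : s < r := hr
      have h3 : s.toNNReal + (r - s).toNNReal = r.toNNReal := by
        rw [← Real.toNNReal_add hs.1 (sub_pos.2 hr').le]; congr 1; ring
      simp only [Function.comp_apply, slope_def_module]
      rw [h3, Real.coe_toNNReal _ (sub_pos.2 hr').le, ← Complex.ofReal_inv, Complex.coe_smul]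
    · intro s _
      obtain ⟨hm, h1, -⟩ := hgen x s.toNNReal
      rw [← h1]
      exact hdiss ⟨_, hm⟩
  refine ContinuousLinearMap.opNorm_le_bound _ (Real.exp_pos _).le fun x => ?_
  refine hd.induction (P := fun x => ‖T t x‖ ≤ Real.exp (c * t) * ‖x‖) (fun x hx => hdom ⟨x, hx⟩)
    (isClosed_le (by fun_prop) (by fun_prop)) x

end GrowthBound

open LineDeriv Laplacian

/-! ### Integration by parts and coercivity on Schwartz functions -/

section SchwartzCalculus

/-- The embedding of the Schwartz space into `L²(ℝ³)`. -/
def schwartzToL2 : 𝓢(R3, ℂ) →L[ℂ] L2 := SchwartzMap.toLpCLM ℂ ℂ 2 volume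

theorem denseRange_schwartzToL2 : DenseRange schwartzToL2 :=
  SchwartzMap.denseRange_toLpCLM (by norm_num)

theorem inner_schwartzToL2 (φ ψ : 𝓢(R3, ℂ)) :
    inner ℂ (schwartzToL2 φ) (schwartzToL2 ψ) = ∫ x, starRingEnd ℂ (φ x) * ψ x := by
  refine (SchwartzMap.inner_toL2_toL2_eq φ ψ).trans ?_
  simp [mul_comm]

theorem inner_lineDerivOp_left (m : R3) (φ ψ : 𝓢(R3, ℂ)) :
    inner ℂ (schwartzToL2 (∂_{m} φ)) (schwartzToL2 ψ) =
      -inner ℂ (schwartzToL2 φ) (schwartzToL2 (∂_{m} ψ)) := by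
  have h := SchwartzMap.integral_bilinear_lineDerivOp_right_eq_neg_left (μ := volume) φ ψ
    ((ContinuousLinearMap.mul ℝ ℂ).comp (Complex.conjCLE : ℂ →L[ℝ] ℂ)) m
  simp only [inner_schwartzToL2]
  simpa [neg_eq_iff_eq_neg] using h.symm

theorem inner_smulLeftCLM_left {g : R3 → ℂ} (hg : g.HasTemperateGrowth)
    (hreal : ∀ x, starRingEnd ℂ (g x) = g x) (φ ψ : 𝓢(R3, ℂ)) :
    inner ℂ (schwartzToL2 (SchwartzMap.smulLeftCLM ℂ g φ)) (schwartzToL2 ψ) =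
      inner ℂ (schwartzToL2 φ) (schwartzToL2 (SchwartzMap.smulLeftCLM ℂ g ψ)) := by
  simp only [inner_schwartzToL2]
  congr 1
  ext x
  rw [SchwartzMap.smulLeftCLM_apply_apply hg, SchwartzMap.smulLeftCLM_apply_apply hg]
  simp only [smul_eq_mul, map_mul, hreal]
  ring

theorem lineDerivOp_smulLeftCLM_of_invariant {g : R3 → ℂ} (hg : g.HasTemperateGrowth) {m : R3}
    (hm : ∀ (x : R3) (t : ℝ), g (x + t • m) = g x) (φ : 𝓢(R3, ℂ)) :
    ∂_{m} (SchwartzMap.smulLeftCLM ℂ g φ) = SchwartzMap.smulLeftCLM ℂ g (∂_{m} φ) := by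
  ext x
  rw [SchwartzMap.smulLeftCLM_apply_apply hg, SchwartzMap.lineDerivOp_apply,
    SchwartzMap.lineDerivOp_apply]
  simp only [lineDeriv, SchwartzMap.smulLeftCLM_apply_apply hg, hm, smul_eq_mul]
  exact deriv_const_mul_field _

/-- The function `(x, y, z) ↦ y`. -/
def yCoord (p : R3) : ℂ := ((p 1 : ℝ) : ℂ)

theorem yCoord_hasTemperateGrowth : yCoord.HasTemperateGrowth := by
  unfold yCoord
  have h : Function.HasTemperateGrowth (fun p : R3 =>
    (Complex.ofRealCLM.comp (EuclideanSpace.proj (𝕜 := ℝ) (1 : Fin 3))) p) := by fun_prop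
  exact h

theorem lineDerivOp_smulLeftCLM_yCoord (i : Fin 3) (φ : 𝓢(R3, ℂ)) :
    ∂_{unitVec i} (SchwartzMap.smulLeftCLM ℂ yCoord φ) =
      SchwartzMap.smulLeftCLM ℂ yCoord (∂_{unitVec i} φ) + if i = 1 then φ else 0 := by
  split_ifs with hi
  · subst hi
    ext x
    rw [add_apply, SchwartzMap.smulLeftCLM_apply_apply yCoord_hasTemperateGrowth,
      SchwartzMap.lineDerivOp_apply, SchwartzMap.lineDerivOp_apply]
    simp only [lineDeriv, SchwartzMap.smulLeftCLM_apply_apply yCoord_hasTemperateGrowth,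
      smul_eq_mul]
    have h1 : HasDerivAt (fun t : ℝ => yCoord (x + t • unitVec 1)) 1 0 := by
      have : (fun t : ℝ => yCoord (x + t • unitVec 1)) = fun t : ℝ => yCoord x + (t : ℂ) := by
        ext t
        simp [yCoord, unitVec]
      rw [this]
      exact (Complex.ofRealCLM.hasDerivAt (x := (0 : ℝ))).const_add _
    have h2 : HasDerivAt (fun t : ℝ => φ (x + t • unitVec 1))
        (deriv (fun t : ℝ => φ (x + t • unitVec 1)) 0) 0 := by
      refine DifferentiableAt.hasDerivAt ?_
      have := φ.differentiable
      fun_prop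
    rw [(h1.fun_mul h2).deriv]
    simp [add_comm]
  · rw [add_zero]
    refine lineDerivOp_smulLeftCLM_of_invariant yCoord_hasTemperateGrowth (fun x t => ?_) φ
    have : (unitVec i : R3) 1 = 0 := by
      simp [unitVec, Ne.symm hi]
    simp [yCoord, this]

/-- The transport operator `y ∂ₓ` on Schwartz functions. -/
def yDx (φ : 𝓢(R3, ℂ)) : 𝓢(R3, ℂ) := SchwartzMap.smulLeftCLM ℂ yCoord (∂_{unitVec 0} φ)

theorem inner_yDx_left (φ ψ : 𝓢(R3, ℂ)) :
    inner ℂ (schwartzToL2 (yDx φ)) (schwartzToL2 ψ) =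
      -inner ℂ (schwartzToL2 φ) (schwartzToL2 (yDx ψ)) := by
  rw [yDx, inner_smulLeftCLM_left yCoord_hasTemperateGrowth (by simp [yCoord]),
    inner_lineDerivOp_left, lineDerivOp_smulLeftCLM_yCoord, if_neg (by decide), add_zero, yDx]

/-- Both derivatives are Fourier multipliers, and their symbols commute. -/
theorem lineDerivOp_comm (m n : R3) (φ : 𝓢(R3, ℂ)) : ∂_{m} (∂_{n} φ) = ∂_{n} (∂_{m} φ) := by
  have h : ∀ (m : R3) (φ : 𝓢(R3, ℂ)), ∂_{m} φ = (2 * Real.pi * Complex.I) •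
      SchwartzMap.fourierMultiplierCLM ℂ (fun x => RCLike.ofReal (K := ℂ) (inner ℝ x m)) φ := by
    intro m φ
    rw [SchwartzMap.lineDeriv_eq_fourierMultiplierCLM,
      SchwartzMap.fourierMultiplierCLM_ofReal ℂ (by fun_prop)]
  simp only [h, map_smul]
  rw [SchwartzMap.fourierMultiplierCLM_fourierMultiplierCLM_apply (by fun_prop) (by fun_prop),
    SchwartzMap.fourierMultiplierCLM_fourierMultiplierCLM_apply (by fun_prop) (by fun_prop),
    mul_comm (fun x : R3 => RCLike.ofReal (K := ℂ) (inner ℝ x m))]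

theorem lineDerivOp_yDx (i : Fin 3) (φ : 𝓢(R3, ℂ)) :
    ∂_{unitVec i} (yDx φ) = yDx (∂_{unitVec i} φ) + if i = 1 then ∂_{unitVec 0} φ else 0 := by
  rw [yDx, lineDerivOp_smulLeftCLM_yCoord, yDx, lineDerivOp_comm]

theorem laplacian_eq_sum_unitVec (φ : 𝓢(R3, ℂ)) :
    Δ φ = ∑ i, ∂_{unitVec i} (∂_{unitVec i} φ) := by
  rw [SchwartzMap.laplacian_eq_sum (EuclideanSpace.basisFun (Fin 3) ℝ)]
  simp [unitVec]

theorem inner_laplacian_left (φ ψ : 𝓢(R3, ℂ)) :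
    inner ℂ (schwartzToL2 (Δ φ)) (schwartzToL2 ψ) =
      -∑ i, inner ℂ (schwartzToL2 (∂_{unitVec i} φ)) (schwartzToL2 (∂_{unitVec i} ψ)) := by
  rw [laplacian_eq_sum_unitVec, map_sum, sum_inner, ← Finset.sum_neg_distrib]
  exact Finset.sum_congr rfl fun i _ => inner_lineDerivOp_left _ _ _

theorem inner_laplacian_right (φ ψ : 𝓢(R3, ℂ)) :
    inner ℂ (schwartzToL2 φ) (schwartzToL2 (Δ ψ)) =
      -∑ i, inner ℂ (schwartzToL2 (∂_{unitVec i} φ)) (schwartzToL2 (∂_{unitVec i} ψ)) := by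
  rw [← inner_conj_symm, inner_laplacian_left, map_neg, map_sum]
  simp only [inner_conj_symm]

theorem re_inner_yDx_self (φ : 𝓢(R3, ℂ)) :
    (inner ℂ (schwartzToL2 φ) (schwartzToL2 (yDx φ))).re = 0 := by
  have h := congrArg Complex.re (inner_yDx_left φ φ)
  rw [← inner_conj_symm, Complex.conj_re, Complex.neg_re] at h
  linarith

theorem re_inner_self_eq (u : L2) : (inner ℂ u u : ℂ).re = ‖u‖ ^ 2 := by
  rw [inner_self_eq_norm_sq_to_K]; norm_cast

/-- The squared `L²` norm of the gradient. -/
def gradSq (φ : 𝓢(R3, ℂ)) : ℝ := ∑ i, ‖schwartzToL2 (∂_{unitVec i} φ)‖ ^ 2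

theorem gradSq_nonneg (φ : 𝓢(R3, ℂ)) : 0 ≤ gradSq φ := by unfold gradSq; positivity

theorem re_inner_laplacian_self (φ : 𝓢(R3, ℂ)) :
    (inner ℂ (schwartzToL2 φ) (schwartzToL2 (Δ φ))).re = -gradSq φ := by
  rw [inner_laplacian_right, Complex.neg_re, Complex.re_sum]
  simp only [re_inner_self_eq, gradSq]

/-- After one integration by parts, each `⟪∂ᵢφ, y∂ₓ∂ᵢφ⟫` has zero real part. Only the commutator
`[∂_y, y∂ₓ] = ∂ₓ` survives, leaving `-Re ⟪∂_yφ, ∂ₓφ⟫`. -/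
theorem re_inner_laplacian_yDx (φ : 𝓢(R3, ℂ)) :
    (inner ℂ (schwartzToL2 (Δ φ)) (schwartzToL2 (yDx φ))).re ≤ gradSq φ / 2 := by
  have h1 : (inner ℂ (schwartzToL2 (Δ φ)) (schwartzToL2 (yDx φ))).re =
      -(inner ℂ (schwartzToL2 (∂_{unitVec 1} φ)) (schwartzToL2 (∂_{unitVec 0} φ))).re := by
    rw [inner_laplacian_left, Complex.neg_re, Complex.re_sum]
    simp only [lineDerivOp_yDx, map_add, inner_add_right, Complex.add_re, re_inner_yDx_self,
      zero_add, Fin.sum_univ_three]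
    simp
  have h2 := (abs_le.1 ((Complex.abs_re_le_norm _).trans (norm_inner_le_norm (𝕜 := ℂ)
    (schwartzToL2 (∂_{unitVec 1} φ)) (schwartzToL2 (∂_{unitVec 0} φ))))).1
  rw [h1, gradSq, Fin.sum_univ_three]
  nlinarith [sq_nonneg (‖schwartzToL2 (∂_{unitVec 1} φ)‖ - ‖schwartzToL2 (∂_{unitVec 0} φ)‖),
    sq_nonneg ‖schwartzToL2 (∂_{unitVec 2} φ)‖]

theorem norm_sq_sub_laplacian (k : ℝ) (φ : 𝓢(R3, ℂ)) :
    ‖schwartzToL2 (φ - (k : ℂ) • Δ φ)‖ ^ 2 =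
      ‖schwartzToL2 φ‖ ^ 2 + 2 * k * gradSq φ + k ^ 2 * ‖schwartzToL2 (Δ φ)‖ ^ 2 := by
  rw [map_sub, map_smul, @norm_sub_sq ℂ, inner_smul_right, norm_smul, mul_pow, Complex.norm_real,
    Real.norm_eq_abs, sq_abs]
  have := re_inner_laplacian_self φ
  simp only [RCLike.re_to_complex, Complex.re_ofReal_mul, this]
  ring

/-- The `H²` coercivity estimate for `λ - ν Δ + y ∂ₓ`. -/
theorem coercive_estimate {k ν l : ℝ} (hk : 0 < k) (hl : ν / k + 1 ≤ l)
    (φ : 𝓢(R3, ℂ)) :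
    ν / k * ‖schwartzToL2 (φ - (k : ℂ) • Δ φ)‖ ^ 2 ≤
      (inner ℂ (schwartzToL2 (φ - (k : ℂ) • Δ φ))
        (schwartzToL2 ((l : ℂ) • φ - (ν : ℂ) • Δ φ + yDx φ))).re := by
  have h1 := re_inner_laplacian_self φ
  have h2 := re_inner_yDx_self φ
  have h3 := re_inner_laplacian_yDx φ
  have h4 : (inner ℂ (schwartzToL2 (Δ φ)) (schwartzToL2 φ)).re = -gradSq φ := by
    rw [← h1, ← inner_conj_symm, Complex.conj_re]
  have h5 : (inner ℂ (schwartzToL2 (φ - (k : ℂ) • Δ φ))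
        (schwartzToL2 ((l : ℂ) • φ - (ν : ℂ) • Δ φ + yDx φ))).re =
      l * ‖schwartzToL2 φ‖ ^ 2 + (l * k + ν) * gradSq φ + k * ν * ‖schwartzToL2 (Δ φ)‖ ^ 2
        - k * (inner ℂ (schwartzToL2 (Δ φ)) (schwartzToL2 (yDx φ))).re := by
    simp only [map_add, map_sub, map_smul, inner_add_right, inner_sub_left, inner_sub_right,
      inner_smul_left, inner_smul_right, Complex.add_re, Complex.sub_re, Complex.conj_ofReal,
      Complex.re_ofReal_mul, re_inner_self_eq, h1, h2, h4]
    ring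
  rw [h5, norm_sq_sub_laplacian]
  have h6 := gradSq_nonneg φ
  have h7 : ν / k * (‖schwartzToL2 φ‖ ^ 2 + 2 * k * gradSq φ + k ^ 2 * ‖schwartzToL2 (Δ φ)‖ ^ 2) =
      ν / k * ‖schwartzToL2 φ‖ ^ 2 + 2 * ν * gradSq φ + k * ν * ‖schwartzToL2 (Δ φ)‖ ^ 2 := by
    field_simp
  -- The summand 1 in `hl` leaves a spare `k * gradSq φ`, which absorbs the commutator term `k *
  -- gradSq φ / 2`.
  have h8 : ν + k ≤ l * k := by
    have := mul_le_mul_of_nonneg_right hl hk.le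
    rwa [add_mul, div_mul_cancel₀ _ hk.ne', one_mul] at this
  rw [h7]
  have h9 : ν / k * ‖schwartzToL2 φ‖ ^ 2 ≤ l * ‖schwartzToL2 φ‖ ^ 2 := by
    gcongr; linarith
  have h10 := mul_le_mul_of_nonneg_left h3 hk.le
  have h11 := mul_le_mul_of_nonneg_right h8 h6
  nlinarith [mul_nonneg hk.le h6]

end SchwartzCalculus

/-! ### Duality between `L²` and distributions -/

section WeakSolutions

/-- Solvability from an a priori estimate. -/
theorem exists_inner_eq_of_norm_le {Φ H : Type*} [AddCommGroup Φ] [Module ℂ Φ]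
    [NormedAddCommGroup H] [InnerProductSpace ℂ H] [CompleteSpace H] (K : Φ →ₗ[ℂ] H)
    (ℓ : Φ →ₗ[ℂ] ℂ) {C : ℝ} (h : ∀ φ, ‖ℓ φ‖ ≤ C * ‖K φ‖) :
    ∃ w : H, ∀ φ, inner ℂ w (K φ) = ℓ φ := by
  -- The estimate makes `ℓ` a bounded functional of `K φ`; Hahn–Banach extends it and Riesz
  -- represents it.
  obtain ⟨g, hg, -⟩ := exists_extension_norm_eq (𝕜 := ℂ) (LinearMap.range K) (ℓ.compLeftInverse K)
  refine ⟨(InnerProductSpace.toDual ℂ H).symm g, fun φ => ?_⟩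
  rw [InnerProductSpace.toDual_symm_apply]
  exact (hg ⟨K φ, φ, rfl⟩).trans (LinearMap.compLeftInverse_apply_of_bdd _ _ ⟨C, h⟩ φ _ rfl)

theorem toDistr_apply (u : L2) (φ : 𝓢(R3, ℂ)) : toDistr u φ = ∫ x, φ x * u x :=
  Lp.toTemperedDistribution_apply u φ

/-- The distributional pairing is bilinear and the inner product conjugates its first slot, so a
conjugation mediates between them. -/
theorem inner_star_schwartzToL2 (u : L2) (φ : 𝓢(R3, ℂ)) :
    inner ℂ (star u) (schwartzToL2 φ) = toDistr u φ := by
  rw [toDistr_apply, L2.inner_def]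
  refine integral_congr_ae ?_
  filter_upwards [Lp.coeFn_star u, φ.coeFn_toLp 2 volume] with x hx hφ
  have hφ' : schwartzToL2 φ x = φ x := hφ
  rw [hx, hφ']
  simp

theorem toDistr_schwartzToL2 (φ : 𝓢(R3, ℂ)) :
    toDistr (schwartzToL2 φ) = (φ : 𝓢'(R3, ℂ)) :=
  Lp.toTemperedDistribution_toLp_eq φ

theorem continuous_toDistr_apply (φ : 𝓢(R3, ℂ)) : Continuous fun u : L2 => toDistr u φ := by
  exact (PointwiseConvergenceCLM.evalCLM (RingHom.id ℂ) ℂ φ).continuous.comp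
    (Lp.toTemperedDistributionCLM ℂ (volume : Measure R3) 2).continuous

theorem laplacianDistr_apply (u : 𝓢'(R3, ℂ)) (φ : 𝓢(R3, ℂ)) : laplacianDistr u φ = u (Δ φ) := by
  simp [laplacianDistr]

theorem yDxDistr_apply (u : 𝓢'(R3, ℂ)) (φ : 𝓢(R3, ℂ)) : yDxDistr u φ = -u (yDx φ) := by
  have h1 : yDxDistr u φ = u (-∂_{unitVec 0} (SchwartzMap.smulLeftCLM ℂ yCoord φ)) := rfl
  rw [h1, lineDerivOp_smulLeftCLM_yCoord, if_neg (by decide), add_zero, map_neg]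
  rfl

end WeakSolutions

/-! ### The operator `1 - κΔ`, approximation in `H²` and solvability -/

section EllipticOperator

/-- The normalization for which `1 - κ Δ` has the symbol `1 + |ξ|²`. -/
def ellipticScale : ℝ := ((2 * Real.pi) ^ 2)⁻¹

theorem ellipticScale_pos : 0 < ellipticScale := by unfold ellipticScale; positivity

/-- The operator `1 - κ Δ` on Schwartz functions. -/
def ellipticOp : 𝓢(R3, ℂ) →ₗ[ℂ] 𝓢(R3, ℂ) :=
  LinearMap.id - (ellipticScale : ℂ) • (laplacianCLM ℂ R3 𝓢(R3, ℂ)).toLinearMap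

theorem ellipticOp_apply (φ : 𝓢(R3, ℂ)) : ellipticOp φ = φ - (ellipticScale : ℂ) • Δ φ := by
  simp [ellipticOp]

/-- The inverse of `1 - κ Δ` on Schwartz functions. -/
def ellipticInv : 𝓢(R3, ℂ) →L[ℂ] 𝓢(R3, ℂ) :=
  SchwartzMap.fourierMultiplierCLM ℂ (fun x : R3 => (((1 + ‖x‖ ^ 2) ^ (-1 : ℝ) : ℝ) : ℂ))

theorem ellipticOp_eq_fourierMultiplierCLM (φ : 𝓢(R3, ℂ)) :
    ellipticOp φ = SchwartzMap.fourierMultiplierCLM ℂ (fun x : R3 => ((1 + ‖x‖ ^ 2 : ℝ) : ℂ)) φ := by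
  have h1 : (fun x : R3 => ((1 + ‖x‖ ^ 2 : ℝ) : ℂ)) =
      (fun _ => (1 : ℂ)) + fun x => ((‖x‖ ^ 2 : ℝ) : ℂ) := by
    ext x; simp
  have h2 : SchwartzMap.fourierMultiplierCLM ℂ (fun x : R3 => ((‖x‖ ^ 2 : ℝ) : ℂ)) φ =
      SchwartzMap.fourierMultiplierCLM ℂ (fun x : R3 => ‖x‖ ^ 2) φ :=
    SchwartzMap.fourierMultiplierCLM_ofReal ℂ
      (Function.hasTemperateGrowth_norm_sq (H := R3)) φ
  rw [SchwartzMap.fourierMultiplierCLM_apply, h1,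
    SchwartzMap.smulLeftCLM_add (by fun_prop) (by fun_prop), add_apply,
    FourierTransform.fourierInv_add, ← SchwartzMap.fourierMultiplierCLM_apply,
    ← SchwartzMap.fourierMultiplierCLM_apply, h2, SchwartzMap.fourierMultiplierCLM_const,
    ellipticOp_apply, SchwartzMap.laplacian_eq_fourierMultiplierCLM]
  have h3 : ellipticScale * (2 * Real.pi) ^ 2 = 1 := by
    unfold ellipticScale; exact inv_mul_cancel₀ (by positivity)
  rw [Complex.coe_smul, smul_smul, mul_neg, h3, neg_smul, one_smul, sub_neg_eq_add, one_smul]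
  rfl

theorem ellipticOp_ellipticInv (φ : 𝓢(R3, ℂ)) : ellipticOp (ellipticInv φ) = φ := by
  rw [ellipticOp_eq_fourierMultiplierCLM, ellipticInv,
    SchwartzMap.fourierMultiplierCLM_fourierMultiplierCLM_apply (by fun_prop) (by fun_prop)]
  have h : ((fun x : R3 => ((1 + ‖x‖ ^ 2 : ℝ) : ℂ)) *
      fun x : R3 => (((1 + ‖x‖ ^ 2) ^ (-1 : ℝ) : ℝ) : ℂ)) = fun _ => 1 := by
    ext x
    rw [Pi.mul_apply, ← Complex.ofReal_mul, Real.rpow_neg_one, mul_inv_cancel₀ (by positivity),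
      Complex.ofReal_one]
  rw [h, SchwartzMap.fourierMultiplierCLM_const]
  simp

theorem inner_ellipticOp_left (φ ψ : 𝓢(R3, ℂ)) :
    inner ℂ (schwartzToL2 (ellipticOp φ)) (schwartzToL2 ψ) =
      inner ℂ (schwartzToL2 φ) (schwartzToL2 (ellipticOp ψ)) := by
  simp only [ellipticOp_apply, map_sub, map_smul, inner_sub_left, inner_sub_right,
    inner_smul_left, inner_smul_right, inner_laplacian_left, inner_laplacian_right,
    Complex.conj_ofReal]

/-- Every test function is of the form `(1 - κΔ)φ`. This is the uniqueness statement for `1 - κΔ` on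
`L²`. -/
theorem eq_zero_of_toDistr_ellipticOp {u : L2} (h : ∀ φ, toDistr u (ellipticOp φ) = 0) : u = 0 := by
  refine toDistr_injective ?_
  rw [map_zero]
  ext φ
  rw [← ellipticOp_ellipticInv φ, h]
  rfl

theorem denseRange_ellipticOp : DenseRange (schwartzToL2.toLinearMap ∘ₗ ellipticOp) := by
  have h : Function.Surjective ellipticOp := fun φ => ⟨_, ellipticOp_ellipticInv φ⟩
  rw [LinearMap.coe_comp]
  exact denseRange_schwartzToL2.comp h.denseRange schwartzToL2.continuous

/-- The summands on the left are nonnegative, so `(1 - κΔ)φ` bounds each of `φ`, `∂ₓφ` and `Δφ` in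
`L²`. -/
theorem norm_le_ellipticOp (φ : 𝓢(R3, ℂ)) :
    ‖schwartzToL2 φ‖ ^ 2 + 2 * ellipticScale * gradSq φ +
      ellipticScale ^ 2 * ‖schwartzToL2 (Δ φ)‖ ^ 2 = ‖schwartzToL2 (ellipticOp φ)‖ ^ 2 := by
  rw [ellipticOp_apply, norm_sq_sub_laplacian]

/-- Every element of `L²` is `(1 - κ Δ) u` for some `u` of class `H²`, which is approximated by
Schwartz functions together with its derivatives. The three operators are `(1 - κ Δ)⁻¹`,
`∂ₓ (1 - κ Δ)⁻¹` and `Δ (1 - κ Δ)⁻¹`. -/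
theorem exists_ellipticInverse : ∃ R D E : L2 →L[ℂ] L2, ∀ φ,
    R (schwartzToL2 (ellipticOp φ)) = schwartzToL2 φ ∧
    D (schwartzToL2 (ellipticOp φ)) = schwartzToL2 (∂_{unitVec 0} φ) ∧
    E (schwartzToL2 (ellipticOp φ)) = schwartzToL2 (Δ φ) := by
  have hκ := ellipticScale_pos
  have hR : ∀ φ, ‖schwartzToL2 φ‖ ≤ 1 * ‖schwartzToL2 (ellipticOp φ)‖ := fun φ => by
    rw [one_mul]
    refine le_of_sq_le_sq ?_ (norm_nonneg _)
    rw [← norm_le_ellipticOp]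
    have := gradSq_nonneg φ
    have : 0 ≤ 2 * ellipticScale * gradSq φ := by positivity
    have : 0 ≤ ellipticScale ^ 2 * ‖schwartzToL2 (Δ φ)‖ ^ 2 := by positivity
    linarith
  have hE : ∀ φ, ‖schwartzToL2 (Δ φ)‖ ≤ ellipticScale⁻¹ * ‖schwartzToL2 (ellipticOp φ)‖ :=
    fun φ => by
    rw [← div_eq_inv_mul, le_div_iff₀' hκ]
    refine le_of_sq_le_sq ?_ (norm_nonneg _)
    rw [← norm_le_ellipticOp, mul_pow]
    have := gradSq_nonneg φ
    have : 0 ≤ 2 * ellipticScale * gradSq φ := by positivity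
    have : 0 ≤ ‖schwartzToL2 φ‖ ^ 2 := by positivity
    linarith
  have hD : ∀ φ, ‖schwartzToL2 (∂_{unitVec 0} φ)‖ ≤
      √((2 * ellipticScale)⁻¹) * ‖schwartzToL2 (ellipticOp φ)‖ := fun φ => by
    refine le_of_sq_le_sq ?_ (by positivity)
    rw [mul_pow, Real.sq_sqrt (by positivity), ← norm_le_ellipticOp, ← div_eq_inv_mul,
      le_div_iff₀' (by positivity)]
    have h1 : ‖schwartzToL2 (∂_{unitVec 0} φ)‖ ^ 2 ≤ gradSq φ :=
      Finset.single_le_sum (f := fun i => ‖schwartzToL2 (∂_{unitVec i} φ)‖ ^ 2)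
        (fun i _ => sq_nonneg _) (Finset.mem_univ 0)
    have : 0 ≤ ‖schwartzToL2 φ‖ ^ 2 := by positivity
    have : 0 ≤ ellipticScale ^ 2 * ‖schwartzToL2 (Δ φ)‖ ^ 2 := by positivity
    have := mul_le_mul_of_nonneg_left h1 (by positivity : 0 ≤ 2 * ellipticScale)
    linarith
  have hdense := denseRange_ellipticOp
  refine ⟨schwartzToL2.toLinearMap.extendOfNorm (schwartzToL2.toLinearMap ∘ₗ ellipticOp),
    (schwartzToL2.toLinearMap ∘ₗ (lineDerivOpCLM ℂ 𝓢(R3, ℂ) (unitVec 0)).toLinearMap).extendOfNorm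
      (schwartzToL2.toLinearMap ∘ₗ ellipticOp),
    (schwartzToL2.toLinearMap ∘ₗ (laplacianCLM ℂ R3 𝓢(R3, ℂ)).toLinearMap).extendOfNorm
      (schwartzToL2.toLinearMap ∘ₗ ellipticOp), fun φ => ⟨?_, ?_, ?_⟩⟩
  · exact LinearMap.extendOfNorm_eq hdense ⟨_, hR⟩ φ
  · exact LinearMap.extendOfNorm_eq hdense ⟨_, hD⟩ φ
  · refine (LinearMap.extendOfNorm_eq hdense ⟨ellipticScale⁻¹, fun φ => ?_⟩ φ).trans ?_
    · simpa using hE φ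
    · simp

/-- Each identity is closed under `L²` limits of `w`, distributional ones after testing, and holds
on the dense range of `1 - κΔ` on Schwartz functions. -/
theorem ellipticInverse_spec {R D E : L2 →L[ℂ] L2}
    (hR : ∀ φ, R (schwartzToL2 (ellipticOp φ)) = schwartzToL2 φ)
    (hD : ∀ φ, D (schwartzToL2 (ellipticOp φ)) = schwartzToL2 (∂_{unitVec 0} φ))
    (hE : ∀ φ, E (schwartzToL2 (ellipticOp φ)) = schwartzToL2 (Δ φ)) (w : L2) :
    R w - (ellipticScale : ℂ) • E w = w ∧ toDistr (E w) = laplacianDistr (toDistr (R w)) ∧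
      toDistr (D w) = ∂_{unitVec 0} (toDistr (R w)) := by
  refine ⟨?_, ?_, ?_⟩
  · refine denseRange_ellipticOp.induction_on
      (p := fun w => R w - (ellipticScale : ℂ) • E w = w) w
      (isClosed_eq (by fun_prop) (by fun_prop)) fun φ => ?_
    simp only [LinearMap.comp_apply, ContinuousLinearMap.coe_coe, hR, hE]
    rw [← map_smul, ← map_sub, ellipticOp_apply]
  · ext ψ
    rw [laplacianDistr_apply]
    refine denseRange_ellipticOp.induction_on
      (p := fun w => toDistr (E w) ψ = toDistr (R w) (Δ ψ)) w
      (isClosed_eq ((continuous_toDistr_apply _).comp E.continuous)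
        ((continuous_toDistr_apply _).comp R.continuous)) fun φ => ?_
    simp only [LinearMap.comp_apply, ContinuousLinearMap.coe_coe, hR, hE]
    rw [toDistr_schwartzToL2, toDistr_schwartzToL2,
      ← TemperedDistribution.laplacian_toTemperedDistributionCLM_eq,
      TemperedDistribution.laplacian_apply_apply]
  · ext ψ
    rw [TemperedDistribution.lineDerivOp_apply_apply]
    refine denseRange_ellipticOp.induction_on
      (p := fun w => toDistr (D w) ψ = toDistr (R w) (-∂_{unitVec 0} ψ)) w
      (isClosed_eq ((continuous_toDistr_apply _).comp D.continuous)
        ((continuous_toDistr_apply _).comp R.continuous)) fun φ => ?_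
    simp only [LinearMap.comp_apply, ContinuousLinearMap.coe_coe, hR, hD]
    rw [toDistr_schwartzToL2, toDistr_schwartzToL2,
      ← TemperedDistribution.lineDerivOp_toTemperedDistributionCLM_eq,
      TemperedDistribution.lineDerivOp_apply_apply]

theorem toDistr_apply_ellipticOp {u d : L2} (h : toDistr d = laplacianDistr (toDistr u))
    (ψ : 𝓢(R3, ℂ)) : toDistr u (ellipticOp ψ) = toDistr (u - (ellipticScale : ℂ) • d) ψ := by
  rw [ellipticOp_apply, map_sub, map_smul, ← laplacianDistr_apply, ← h, map_sub, map_smul]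
  rfl

/-- `L²` functions with Laplacian in `L²` are limits of Schwartz functions in the graph norms of
`Δ` and `∂ₓ`. -/
theorem exists_seq_of_laplacian_mem {u d : L2} (h : toDistr d = laplacianDistr (toDistr u)) :
    ∃ (φ : ℕ → 𝓢(R3, ℂ)) (v : L2), toDistr v = ∂_{unitVec 0} (toDistr u) ∧
      Tendsto (fun n => schwartzToL2 (φ n)) atTop (𝓝 u) ∧
      Tendsto (fun n => schwartzToL2 (∂_{unitVec 0} (φ n))) atTop (𝓝 v) ∧
      Tendsto (fun n => schwartzToL2 (Δ (φ n))) atTop (𝓝 d) := by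
  obtain ⟨R, D, E, hRDE⟩ := exists_ellipticInverse
  have hspec := ellipticInverse_spec (fun φ => (hRDE φ).1) (fun φ => (hRDE φ).2.1)
    (fun φ => (hRDE φ).2.2)
  set w := u - (ellipticScale : ℂ) • d with hw
  obtain ⟨hw1, hw2, hw3⟩ := hspec w
  -- Both `R w` and `u` solve `(1 - κΔ)· = w` in the sense of distributions.
  have hRw : R w = u := by
    rw [← sub_eq_zero]
    refine eq_zero_of_toDistr_ellipticOp fun ψ => ?_
    have h1 := toDistr_apply_ellipticOp hw2 ψ
    have h2 := toDistr_apply_ellipticOp h ψ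
    rw [hw1] at h1
    rw [← hw, ← h1] at h2
    rw [map_sub]
    exact sub_eq_zero.2 h2.symm
  have hEw : E w = d := by
    rw [hRw] at hw1
    have h1 := sub_right_injective (hw1.trans hw)
    exact smul_right_injective L2 (Complex.ofReal_ne_zero.2 ellipticScale_pos.ne') h1
  obtain ⟨x, hx, hxw⟩ := mem_closure_iff_seq_limit.1 (denseRange_ellipticOp w)
  choose φ hφ using hx
  have hφ' : ∀ n, x n = schwartzToL2 (ellipticOp (φ n)) := fun n => (hφ n).symm
  refine ⟨φ, D w, hRw ▸ hw3, ?_, ?_, ?_⟩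
  · rw [← hRw]
    exact ((R.continuous.tendsto w).comp hxw).congr fun n => by
      rw [Function.comp_apply, hφ', (hRDE _).1]
  · exact ((D.continuous.tendsto w).comp hxw).congr fun n => by
      rw [Function.comp_apply, hφ', (hRDE _).2.1]
  · rw [← hEw]
    exact ((E.continuous.tendsto w).comp hxw).congr fun n => by
      rw [Function.comp_apply, hφ', (hRDE _).2.2]

/-- The equation `λ u - ν Δ u + y ∂ₓ u = g` is solvable in the class of `u ∈ L²` with `Δ u ∈ L²`. -/
theorem exists_solution {ν l : ℝ} (hν : 0 < ν) (hl : ν / ellipticScale + 1 ≤ l) (g : L2) :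
    ∃ u d : L2, toDistr d = laplacianDistr (toDistr u) ∧
      (l : ℂ) • toDistr u - (ν : ℂ) • toDistr d + yDxDistr (toDistr u) = toDistr g := by
  have hκ := ellipticScale_pos
  -- The formal adjoint of `l - νΔ + y∂ₓ`: only the transport term changes sign.
  let L' : 𝓢(R3, ℂ) →ₗ[ℂ] 𝓢(R3, ℂ) :=
    (l : ℂ) • LinearMap.id - (ν : ℂ) • (laplacianCLM ℂ R3 𝓢(R3, ℂ)).toLinearMap -
      (SchwartzMap.smulLeftCLM ℂ yCoord).toLinearMap ∘ₗ
        (lineDerivOpCLM ℂ 𝓢(R3, ℂ) (unitVec 0)).toLinearMap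
  have hL' : ∀ ψ, L' ψ = (l : ℂ) • ψ - (ν : ℂ) • Δ ψ - yDx ψ := fun ψ => by
    simp [L', yDx]
  have hadj : ∀ φ ψ, inner ℂ (schwartzToL2 ψ)
      (schwartzToL2 ((l : ℂ) • φ - (ν : ℂ) • Δ φ + yDx φ)) =
      inner ℂ (schwartzToL2 (L' ψ)) (schwartzToL2 φ) := by
    intro φ ψ
    simp only [hL', map_add, map_sub, map_smul, inner_add_right, inner_sub_left, inner_sub_right,
      inner_smul_left, inner_smul_right, inner_laplacian_left, inner_laplacian_right,
      inner_yDx_left, Complex.conj_ofReal]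
    ring
  -- Apply coercivity to `(1 - κΔ)⁻¹ψ` and move both operators across the inner product: `ν/κ ‖ψ‖² ≤
  -- Re ⟪(1 - κΔ)⁻¹L'ψ, ψ⟫`.
  have hest : ∀ ψ, ν / ellipticScale * ‖schwartzToL2 ψ‖ ≤
      ‖schwartzToL2 (ellipticInv (L' ψ))‖ := by
    intro ψ
    have h1 := coercive_estimate (ν := ν) hκ hl (ellipticInv ψ)
    rw [← ellipticOp_apply, ellipticOp_ellipticInv, hadj] at h1
    conv_rhs at h1 => rw [← ellipticOp_ellipticInv (L' ψ), inner_ellipticOp_left,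
      ellipticOp_ellipticInv]
    have h2 := h1.trans ((Complex.re_le_norm _).trans (norm_inner_le_norm _ _))
    rcases (norm_nonneg (schwartzToL2 ψ)).eq_or_lt with h0 | h0
    · rw [← h0, mul_zero]; exact norm_nonneg _
    · refine le_of_mul_le_mul_right ?_ h0
      linarith
  obtain ⟨w', hw'⟩ := exists_inner_eq_of_norm_le
    (schwartzToL2.toLinearMap ∘ₗ ellipticInv.toLinearMap ∘ₗ L') (toDistr g).toLinearMap
    (C := ‖star g‖ * (ν / ellipticScale)⁻¹) fun ψ => by
      have h1 : ‖toDistr g ψ‖ ≤ ‖star g‖ * ‖schwartzToL2 ψ‖ := by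
        rw [← inner_star_schwartzToL2]; exact norm_inner_le_norm _ _
      refine h1.trans ?_
      rw [mul_assoc]
      gcongr
      rw [← div_eq_inv_mul, le_div_iff₀' (by positivity)]
      exact hest ψ
  obtain ⟨R, D, E, hRDE⟩ := exists_ellipticInverse
  obtain ⟨hw1, hw2, -⟩ := ellipticInverse_spec (fun φ => (hRDE φ).1) (fun φ => (hRDE φ).2.1)
    (fun φ => (hRDE φ).2.2) (star w')
  -- Testing `u = (1 - κΔ)⁻¹ (star w')` against `L'ψ` amounts to pairing `w'` with `(1 - κΔ)⁻¹L'ψ`,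
  -- which was arranged to equal `g` tested on `ψ`. The smoothing by `(1 - κΔ)⁻¹` is what puts `Δu`
  -- in `L²`.
  refine ⟨R (star w'), E (star w'), hw2, ?_⟩
  ext ψ
  have h1 := toDistr_apply_ellipticOp hw2 (ellipticInv (L' ψ))
  rw [hw1, ellipticOp_ellipticInv, ← inner_star_schwartzToL2 (star w'), star_star] at h1
  have h2 := h1.trans (hw' ψ)
  rw [hL', map_sub, map_sub, map_smul, map_smul] at h2
  change l • toDistr (R (star w')) ψ - (ν : ℂ) • toDistr (E (star w')) ψ +
    yDxDistr (toDistr (R (star w'))) ψ = toDistr g ψ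
  rw [hw2, laplacianDistr_apply, yDxDistr_apply]
  exact h2

end EllipticOperator

/-! ### Multiplication operators on `L²` -/

section Multiplication

/-- Multiplication by a bounded function on `L²(ℝ³)`. -/
def mulOp {g : R3 → ℂ} (hg : MemLp g ∞ (volume : Measure R3)) : L2 →L[ℂ] L2 :=
  (ContinuousLinearMap.mul ℂ ℂ).holderL volume ∞ 2 2 hg.toLp

theorem coeFn_mulOp {g : R3 → ℂ} (hg : MemLp g ∞ (volume : Measure R3)) (u : L2) :
    mulOp hg u =ᵐ[volume] fun x => g x * u x := by
  have h := (ContinuousLinearMap.mul ℂ ℂ).coeFn_holder (r := 2) hg.toLp u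
  filter_upwards [h, hg.coeFn_toLp] with x hx hg'
  refine hx.trans ?_
  rw [hg']
  rfl

theorem toDistr_mulOp {g : R3 → ℂ} (hg : MemLp g ∞ (volume : Measure R3))
    (hg' : g.HasTemperateGrowth) (u : L2) :
    toDistr (mulOp hg u) = TemperedDistribution.smulLeftCLM ℂ g (toDistr u) := by
  ext φ
  rw [TemperedDistribution.smulLeftCLM_apply_apply, toDistr_apply, toDistr_apply]
  refine integral_congr_ae ?_
  filter_upwards [coeFn_mulOp hg u] with x hx
  rw [hx, SchwartzMap.smulLeftCLM_apply_apply hg', smul_eq_mul]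
  ring

theorem mulOp_schwartzToL2 {g : R3 → ℂ} (hg : MemLp g ∞ (volume : Measure R3))
    (hg' : g.HasTemperateGrowth) (φ : 𝓢(R3, ℂ)) :
    mulOp hg (schwartzToL2 φ) = schwartzToL2 (SchwartzMap.smulLeftCLM ℂ g φ) := by
  refine Lp.ext ?_
  filter_upwards [coeFn_mulOp hg (schwartzToL2 φ), φ.coeFn_toLp 2 volume,
    (SchwartzMap.smulLeftCLM ℂ g φ).coeFn_toLp 2 volume] with x h1 h2 h3
  have h2' : schwartzToL2 φ x = φ x := h2
  refine h1.trans (Eq.trans ?_ h3.symm)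
  rw [h2', SchwartzMap.smulLeftCLM_apply_apply hg', smul_eq_mul]

end Multiplication

/-! ### Nonpositivity of `Δ` and antisymmetry of `y∂ₓ` on the maximal domain -/

section Dissipativity

/-- A cutoff in the variable `y`. -/
def yCutoff (ε : ℝ) (p : R3) : ℂ := (((1 + ‖ε * p 1‖ ^ 2) ^ (-1 : ℝ) : ℝ) : ℂ)

theorem yCutoff_hasTemperateGrowth (ε : ℝ) : (yCutoff ε).HasTemperateGrowth := by
  unfold yCutoff
  have h1 : Function.HasTemperateGrowth fun p : R3 => ε * p 1 := by
    have h : Function.HasTemperateGrowth (fun p : R3 =>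
      (ε • (EuclideanSpace.proj (𝕜 := ℝ) (1 : Fin 3))) p) := by fun_prop
    exact h
  have h2 := Function.hasTemperateGrowth_one_add_norm_sq_rpow ℝ (-1 : ℝ)
  exact Function.HasTemperateGrowth.comp Function.Complex.hasTemperateGrowth_ofReal (h2.comp h1)

theorem yCutoff_eq (ε : ℝ) (p : R3) : yCutoff ε p = (((1 + (ε * p 1) ^ 2)⁻¹ : ℝ) : ℂ) := by
  rw [yCutoff, Real.rpow_neg_one, Real.norm_eq_abs, sq_abs]

theorem norm_yCutoff_le (ε : ℝ) (p : R3) : ‖yCutoff ε p‖ ≤ 1 := by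
  rw [yCutoff_eq, Complex.norm_real, Real.norm_of_nonneg (by positivity)]
  exact inv_le_one_of_one_le₀ (by linarith [sq_nonneg (ε * p 1)])

theorem memLp_yCutoff (ε : ℝ) : MemLp (yCutoff ε) ∞ (volume : Measure R3) :=
  memLp_top_of_bound (yCutoff_hasTemperateGrowth ε).1.continuous.aestronglyMeasurable 1
    (Eventually.of_forall (norm_yCutoff_le ε))

theorem memLp_yCutoff_mul_yCoord {ε : ℝ} (hε : 0 < ε) :
    MemLp (yCutoff ε * yCoord) ∞ (volume : Measure R3) := by
  refine memLp_top_of_bound (((yCutoff_hasTemperateGrowth ε).mul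
    yCoord_hasTemperateGrowth).1.continuous.aestronglyMeasurable) ε⁻¹
    (Eventually.of_forall fun p => ?_)
  rw [Pi.mul_apply, norm_mul, yCutoff_eq, yCoord, Complex.norm_real, Complex.norm_real,
    Real.norm_of_nonneg (by positivity), Real.norm_eq_abs, ← div_eq_inv_mul,
    div_le_iff₀ (by positivity), ← div_eq_inv_mul, le_div_iff₀ hε]
  have h := sq_nonneg (|ε * p 1| - 1)
  have h2 : |ε * p 1| = |p 1| * ε := by rw [abs_mul, abs_of_pos hε, mul_comm]
  rw [← sq_abs (ε * p 1), h2] at *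
  nlinarith [sq_nonneg (|p 1| * ε)]

theorem re_inner_laplacian_nonpos {u d : L2} (h : toDistr d = laplacianDistr (toDistr u)) :
    (inner ℂ u d).re ≤ 0 := by
  obtain ⟨φ, v, -, hu, -, hd⟩ := exists_seq_of_laplacian_mem h
  refine le_of_tendsto ((Complex.continuous_re.tendsto _).comp (hu.inner hd))
    (Eventually.of_forall fun n => ?_)
  rw [Function.comp_apply, re_inner_laplacian_self]
  exact neg_nonpos.2 (gradSq_nonneg _)

/-- The approximating Schwartz functions converge together with `∂ₓ`, but not necessarily with
`y∂ₓ`. A cutoff `χ(εy)` turns `y` into a bounded real coefficient independent of `x`, for which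
antisymmetry passes to the limit; then `ε → 0`. -/
theorem re_inner_yDx_eq_zero {u d p : L2} (h : toDistr d = laplacianDistr (toDistr u))
    (hp : toDistr p = yDxDistr (toDistr u)) : (inner ℂ u p).re = 0 := by
  obtain ⟨φ, v, hv, hu, hφ, -⟩ := exists_seq_of_laplacian_mem h
  have hcut : ∀ ε : ℝ, 0 < ε → (inner ℂ u (mulOp (memLp_yCutoff ε) p)).re = 0 := by
    intro ε hε
    have hb := yCutoff_hasTemperateGrowth ε
    have hc := hb.mul yCoord_hasTemperateGrowth
    -- The cut-off transport term depends continuously on `v = ∂ₓu ∈ L²`; this is where `Δu ∈ L²`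
    -- enters.
    have h1 : mulOp (memLp_yCutoff ε) p = mulOp (memLp_yCutoff_mul_yCoord hε) v := by
      refine toDistr_injective ?_
      rw [toDistr_mulOp _ hb, toDistr_mulOp _ hc, hp, hv]
      change TemperedDistribution.smulLeftCLM ℂ (yCutoff ε)
        (TemperedDistribution.smulLeftCLM ℂ yCoord (∂_{unitVec 0} (toDistr u))) = _
      rw [TemperedDistribution.smulLeftCLM_smulLeftCLM_apply yCoord_hasTemperateGrowth hb, mul_comm]
    rw [h1]
    refine tendsto_nhds_unique ((Complex.continuous_re.tendsto _).comp
      (hu.inner (((mulOp (memLp_yCutoff_mul_yCoord hε)).continuous.tendsto v).comp hφ))) ?_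
    refine tendsto_const_nhds.congr fun n => ?_
    simp only [Function.comp_apply]
    rw [mulOp_schwartzToL2 _ hc]
    have h2 : inner ℂ (schwartzToL2 (SchwartzMap.smulLeftCLM ℂ (yCutoff ε * yCoord)
        (∂_{unitVec 0} (φ n)))) (schwartzToL2 (φ n)) = -inner ℂ (schwartzToL2 (φ n))
        (schwartzToL2 (SchwartzMap.smulLeftCLM ℂ (yCutoff ε * yCoord)
        (∂_{unitVec 0} (φ n)))) := by
      rw [inner_smulLeftCLM_left hc (by simp [yCutoff, yCoord]), inner_lineDerivOp_left,
        lineDerivOp_smulLeftCLM_of_invariant hc]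
      intro x t
      simp [yCutoff, yCoord, unitVec]
    have h3 := congrArg Complex.re h2
    rw [← inner_conj_symm, Complex.conj_re, Complex.neg_re] at h3
    linarith
  have hlim : Tendsto (fun n : ℕ => inner ℂ u (mulOp (memLp_yCutoff (1 / ((n : ℝ) + 1))) p)) atTop
      (𝓝 (inner ℂ u p)) := by
    simp only [L2.inner_def]
    refine tendsto_integral_of_dominated_convergence (fun x => ‖inner ℂ (u x) (p x)‖)
      (fun n => (L2.integrable_inner u _).aestronglyMeasurable) (L2.integrable_inner u p).norm
      (fun n => ?_) ?_
    · filter_upwards [coeFn_mulOp (memLp_yCutoff (1 / ((n : ℝ) + 1))) p] with x hx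
      rw [hx, ← smul_eq_mul, inner_smul_right, norm_mul]
      exact mul_le_of_le_one_left (norm_nonneg _) (norm_yCutoff_le _ _)
    · have hall := ae_all_iff.2 fun n : ℕ => coeFn_mulOp (memLp_yCutoff (1 / ((n : ℝ) + 1))) p
      filter_upwards [hall] with x hx
      have h4 : Tendsto (fun n : ℕ => yCutoff (1 / ((n : ℝ) + 1)) x) atTop (𝓝 1) := by
        have h5 : Continuous fun ε : ℝ => (((1 + (ε * x 1) ^ 2)⁻¹ : ℝ) : ℂ) := by
          refine Complex.continuous_ofReal.comp (Continuous.inv₀ (by fun_prop) fun ε => ?_)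
          positivity
        have h6 := (h5.tendsto 0).comp (tendsto_one_div_add_atTop_nhds_zero_nat (𝕜 := ℝ))
        simp only [yCutoff_eq]
        simpa [Function.comp_def] using h6
      have h7 := h4.mul_const (inner ℂ (u x) (p x))
      rw [one_mul] at h7
      refine h7.congr fun n => ?_
      rw [hx n, ← smul_eq_mul (yCutoff _ _) (p x), inner_smul_right]
  refine tendsto_nhds_unique ((Complex.continuous_re.tendsto _).comp hlim) ?_
  exact tendsto_const_nhds.congr fun n => (hcut _ (by positivity)).symm

end Dissipativity

/-! ### The diagonal operator `νΔ - y∂ₓ` -/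

section LStar

theorem mem_lStar_domain {ν : ℝ} {u : L2} : u ∈ (lStar ν).domain ↔
    (∃ d : L2, toDistr d = laplacianDistr (toDistr u)) ∧
      ∃ p : L2, toDistr p = yDxDistr (toDistr u) := Iff.rfl

theorem toDistr_lStar {ν : ℝ} (u : (lStar ν).domain) : toDistr (lStar ν u) =
    (ν : ℂ) • laplacianDistr (toDistr u) - yDxDistr (toDistr u) := by
  obtain ⟨u, hu⟩ := u
  have h1 := toDistr_l2Realization laplacianDistr ⟨u, hu.1⟩
  have h2 := toDistr_l2Realization yDxDistr ⟨u, hu.2⟩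
  rw [← h1, ← h2, ← map_smul, ← map_sub]
  rfl

theorem re_inner_lStar_nonpos {ν : ℝ} (hν : 0 ≤ ν) (u : (lStar ν).domain) :
    (inner ℂ (u : L2) (lStar ν u)).re ≤ 0 := by
  obtain ⟨⟨d, hd⟩, p, hp⟩ := mem_lStar_domain.1 u.2
  have h : lStar ν u = (ν : ℂ) • d - p := by
    refine toDistr_injective ?_
    rw [toDistr_lStar, map_sub, map_smul, hd, hp]
  rw [h, inner_sub_right, inner_smul_right, Complex.sub_re, Complex.re_ofReal_mul,
    re_inner_yDx_eq_zero hd hp, sub_zero]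
  exact mul_nonpos_of_nonneg_of_nonpos hν (re_inner_laplacian_nonpos hd)

/-- The weak solution has `Δu ∈ L²`, and the equation itself expresses `y∂ₓu` through `L²`
functions, so `u` lies in the full domain. -/
theorem lStar_surjective {ν l : ℝ} (hν : 0 < ν) (hl : ν / ellipticScale + 1 ≤ l) (g : L2) :
    ∃ u : (lStar ν).domain, (l : ℂ) • (u : L2) - lStar ν u = g := by
  obtain ⟨u, d, hd, h⟩ := exists_solution hν hl g
  have hp : toDistr (g - (l : ℂ) • u + (ν : ℂ) • d) = yDxDistr (toDistr u) := by
    rw [map_add, map_sub, map_smul, map_smul, ← h]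
    abel
  refine ⟨⟨u, mem_lStar_domain.2 ⟨⟨d, hd⟩, _, hp⟩⟩, toDistr_injective ?_⟩
  rw [map_sub, map_smul, toDistr_lStar, ← h]
  dsimp only
  rw [hd]
  abel

theorem schwartzToL2_mem_lStar_domain (ν : ℝ) (φ : 𝓢(R3, ℂ)) :
    schwartzToL2 φ ∈ (lStar ν).domain := by
  refine mem_lStar_domain.2 ⟨⟨schwartzToL2 (Δ φ), ?_⟩, schwartzToL2 (yDx φ), ?_⟩
  · rw [toDistr_schwartzToL2, toDistr_schwartzToL2,
      ← TemperedDistribution.laplacian_toTemperedDistributionCLM_eq]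
    simp [laplacianDistr]
  · ext ψ
    have h1 : toDistr (schwartzToL2 (yDx φ)) ψ =
        toDistr (schwartzToL2 (∂_{unitVec 0} φ)) (SchwartzMap.smulLeftCLM ℂ yCoord ψ) := by
      rw [toDistr_schwartzToL2, toDistr_schwartzToL2,
        SchwartzMap.toTemperedDistributionCLM_apply_apply volume,
        SchwartzMap.toTemperedDistributionCLM_apply_apply volume]
      congr 1
      ext x
      rw [yDx, SchwartzMap.smulLeftCLM_apply_apply yCoord_hasTemperateGrowth,
        SchwartzMap.smulLeftCLM_apply_apply yCoord_hasTemperateGrowth]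
      simp only [smul_eq_mul]
      ring
    rw [h1, toDistr_schwartzToL2, toDistr_schwartzToL2,
      ← TemperedDistribution.lineDerivOp_toTemperedDistributionCLM_eq]
    rfl

end LStar

/-! ### The quadratic form of the bounded part -/

section BoundedPart

/-- With `e = (a, b, c)` and `s = e·v`, write `f b v₀ + (2-f) a v₁ = (b v₀ + a v₁) + (1-f)(a v₁ - b
v₀)`. Both resulting forms, the first including `-v₀v₁`, are at most `|v|²/2`, and `1 + (1-f) =
2-f`. -/
theorem coupling_form_le_of_unit {f a b c : ℝ} (hf : f ≤ 1) (h : a ^ 2 + b ^ 2 + c ^ 2 = 1)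
    (v₀ v₁ v₂ : ℝ) :
    (a * v₀ + b * v₁ + c * v₂) * (f * b * v₀ + (2 - f) * a * v₁) - v₀ * v₁ ≤
      (2 - f) / 2 * (v₀ ^ 2 + v₁ ^ 2 + v₂ ^ 2) := by
  set s := a * v₀ + b * v₁ + c * v₂ with hs
  have hlag : s ^ 2 + (a * v₁ - b * v₀) ^ 2 + (a * v₂ - c * v₀) ^ 2 + (b * v₂ - c * v₁) ^ 2 =
      v₀ ^ 2 + v₁ ^ 2 + v₂ ^ 2 := by
    rw [hs]
    linear_combination (v₀ ^ 2 + v₁ ^ 2 + v₂ ^ 2) * h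
  have h1 : s * (a * v₁ - b * v₀) ≤ (v₀ ^ 2 + v₁ ^ 2 + v₂ ^ 2) / 2 := by
    nlinarith [sq_nonneg (s - (a * v₁ - b * v₀)), sq_nonneg (a * v₂ - c * v₀),
      sq_nonneg (b * v₂ - c * v₁)]
  -- the reflection `2 s e - v` of `v` has the length of `v`
  have hrefl : (2 * a * s - v₀) ^ 2 + (2 * b * s - v₁) ^ 2 + (2 * c * s - v₂) ^ 2 =
      v₀ ^ 2 + v₁ ^ 2 + v₂ ^ 2 := by
    have : a * v₀ + b * v₁ + c * v₂ = s := hs.symm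
    linear_combination 4 * s ^ 2 * h - 4 * s * this
  -- Twice the left side is the inner product of the reflected vector with `(v₁, v₀, 0)`.
  have h2 : s * (b * v₀ + a * v₁) - v₀ * v₁ ≤ (v₀ ^ 2 + v₁ ^ 2 + v₂ ^ 2) / 2 := by
    nlinarith [sq_nonneg (2 * a * s - v₀ - v₁), sq_nonneg (2 * b * s - v₁ - v₀),
      sq_nonneg (2 * c * s - v₂), sq_nonneg v₂]
  have h3 := mul_le_mul_of_nonneg_left h1 (sub_nonneg.2 hf)
  linarith

/-- The symbol of `lBullet`. -/
def lBulletSymbol (f : ℝ) (ξ : R3) : Matrix (Fin 3) (Fin 3) ℂ :=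
  let a : ℂ := f
  !![a * rieszSymbol 0 1 ξ, (a - 1) + (2 - a) * rieszSymbol 0 0 ξ, 0;
     -a + a * rieszSymbol 1 1 ξ, (2 - a) * rieszSymbol 0 1 ξ, 0;
     a * rieszSymbol 1 2 ξ, (2 - a) * rieszSymbol 0 2 ξ, 0]

/-- The bound for the quadratic form of `lBulletSymbol` on real vectors. -/
theorem coupling_form_le {f : ℝ} (hf : f ≤ 1) (ξ : R3) (v₀ v₁ v₂ : ℝ) :
    v₀ * (f * (ξ 0 * ξ 1 / ‖ξ‖ ^ 2) * v₀ + (f - 1 + (2 - f) * (ξ 0 * ξ 0 / ‖ξ‖ ^ 2)) * v₁) +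
    v₁ * ((-f + f * (ξ 1 * ξ 1 / ‖ξ‖ ^ 2)) * v₀ + (2 - f) * (ξ 0 * ξ 1 / ‖ξ‖ ^ 2) * v₁) +
    v₂ * (f * (ξ 1 * ξ 2 / ‖ξ‖ ^ 2) * v₀ + (2 - f) * (ξ 0 * ξ 2 / ‖ξ‖ ^ 2) * v₁) ≤
      (2 - f) / 2 * (v₀ ^ 2 + v₁ ^ 2 + v₂ ^ 2) := by
  rcases eq_or_ne ξ 0 with rfl | hξ
  -- At the origin the quotients are `0` by the convention for division, and the form reduces to
  -- `-v₀v₁`.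
  · simp only [norm_zero, PiLp.zero_apply]
    norm_num
    nlinarith [sq_nonneg (v₀ + v₁), sq_nonneg v₂, sq_nonneg v₀, sq_nonneg v₁]
  · have hn : ‖ξ‖ ≠ 0 := norm_ne_zero_iff.2 hξ
    have hsq : ξ 0 ^ 2 + ξ 1 ^ 2 + ξ 2 ^ 2 = ‖ξ‖ ^ 2 := by
      rw [EuclideanSpace.real_norm_sq_eq, Fin.sum_univ_three]
    have h1 : (ξ 0 / ‖ξ‖) ^ 2 + (ξ 1 / ‖ξ‖) ^ 2 + (ξ 2 / ‖ξ‖) ^ 2 = 1 := by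
      field_simp
      exact hsq
    refine le_trans (le_of_eq ?_) (coupling_form_le_of_unit hf h1 v₀ v₁ v₂)
    field_simp
    ring

/-- The symbol is a real matrix, so the real part of the form is the sum of its values on the real
and imaginary parts of `v`. -/
theorem re_lBulletSymbol_form_le {f : ℝ} (hf : f ≤ 1) (ξ : R3) (v : Fin 3 → ℂ) :
    ∑ i, (inner ℂ (v i) (∑ j, lBulletSymbol f ξ i j * v j)).re ≤
      (2 - f) / 2 * ∑ i, ‖v i‖ ^ 2 := by
  have hre := coupling_form_le hf ξ (v 0).re (v 1).re (v 2).re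
  have him := coupling_form_le hf ξ (v 0).im (v 1).im (v 2).im
  refine le_trans (le_of_eq ?_) ((add_le_add hre him).trans (le_of_eq ?_))
  · simp only [Fin.sum_univ_three, lBulletSymbol, rieszSymbol, RCLike.inner_apply,
      Matrix.of_apply, Matrix.cons_val]
    generalize ξ 0 * ξ 1 / ‖ξ‖ ^ 2 = r₁
    generalize ξ 0 * ξ 0 / ‖ξ‖ ^ 2 = r₂
    generalize ξ 1 * ξ 1 / ‖ξ‖ ^ 2 = r₃
    generalize ξ 1 * ξ 2 / ‖ξ‖ ^ 2 = r₄
    generalize ξ 0 * ξ 2 / ‖ξ‖ ^ 2 = r₅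
    simp
    ring
  · simp only [Fin.sum_univ_three, Complex.sq_norm, Complex.normSq_apply]
    ring

/-- The Fourier transform on `L²(ℝ³)`. -/
abbrev fourierL2 : L2 ≃ₗᵢ[ℂ] L2 := Lp.fourierTransformₗᵢ R3 ℂ

theorem fourierL2_invLaplacianDD (i j : Fin 3) (u : L2) :
    fourierL2 (invLaplacianDD i j u) = mulOp (memLp_rieszSymbol i j) (fourierL2 u) :=
  fourierL2.apply_symm_apply _

theorem fourierL2_smul_add_smul (c d : ℂ) (i j : Fin 3) (u : L2) :
    fourierL2 ((c • ContinuousLinearMap.id ℂ L2 + d • invLaplacianDD i j) u) =ᵐ[volume]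
      fun ξ => (c + d * rieszSymbol i j ξ) * fourierL2 u ξ := by
  have h : fourierL2 ((c • ContinuousLinearMap.id ℂ L2 + d • invLaplacianDD i j) u) =
      c • fourierL2 u + d • mulOp (memLp_rieszSymbol i j) (fourierL2 u) := by
    rw [← fourierL2_invLaplacianDD, ← map_smul, ← map_smul, ← map_add]
    rfl
  rw [h]
  filter_upwards [Lp.coeFn_add (c • fourierL2 u) (d • mulOp (memLp_rieszSymbol i j) (fourierL2 u)),
    Lp.coeFn_smul c (fourierL2 u), Lp.coeFn_smul d (mulOp (memLp_rieszSymbol i j) (fourierL2 u)),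
    coeFn_mulOp (memLp_rieszSymbol i j) (fourierL2 u)] with ξ h1 h2 h3 h4
  rw [h1, Pi.add_apply, h2, h3, Pi.smul_apply, Pi.smul_apply, h4, smul_eq_mul, smul_eq_mul]
  ring

theorem fourierL2_lBullet (f : ℝ) (i j : Fin 3) (u : L2) :
    fourierL2 (lBullet f i j u) =ᵐ[volume] fun ξ => lBulletSymbol f ξ i j * fourierL2 u ξ := by
  -- Every entry of the matrix is a scalar plus a multiple of a single `Δ⁻¹∂ₚ∂_q`.
  have key : ∀ (c d : ℂ) (p q : Fin 3),
      lBullet f i j = c • ContinuousLinearMap.id ℂ L2 + d • invLaplacianDD p q →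
      (∀ ξ, lBulletSymbol f ξ i j = c + d * rieszSymbol p q ξ) →
      fourierL2 (lBullet f i j u) =ᵐ[volume] fun ξ => lBulletSymbol f ξ i j * fourierL2 u ξ := by
    intro c d p q h1 h2
    rw [h1]
    simp only [h2]
    exact fourierL2_smul_add_smul c d p q u
  fin_cases i <;> fin_cases j
  · exact key 0 f 0 1 (by simp [lBullet]) (by simp [lBulletSymbol])
  · exact key (f - 1) (2 - f) 0 0 (by simp [lBullet]) (by simp [lBulletSymbol])
  · exact key 0 0 0 0 (by simp [lBullet]) (by simp [lBulletSymbol])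
  · exact key (-f) f 1 1 (by simp [lBullet]) (by simp [lBulletSymbol])
  · exact key 0 (2 - f) 0 1 (by simp [lBullet]) (by simp [lBulletSymbol])
  · exact key 0 0 0 0 (by simp [lBullet]) (by simp [lBulletSymbol])
  · exact key 0 f 1 2 (by simp [lBullet]) (by simp [lBulletSymbol])
  · exact key 0 (2 - f) 0 2 (by simp [lBullet]) (by simp [lBulletSymbol])
  · exact key 0 0 0 0 (by simp [lBullet]) (by simp [lBulletSymbol])

theorem re_inner_lBullet_le {f : ℝ} (hf : f ≤ 1) (u : Fin 3 → L2) :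
    ∑ i, (inner ℂ (u i) (∑ j, lBullet f i j (u j))).re ≤ (2 - f) / 2 * ∑ i, ‖u i‖ ^ 2 := by
  set U : Fin 3 → L2 := fun i => fourierL2 (u i) with hU
  set V : Fin 3 → L2 := fun i => fourierL2 (∑ j, lBullet f i j (u j)) with hV
  have hVae : ∀ i, V i =ᵐ[volume] fun ξ => ∑ j, lBulletSymbol f ξ i j * U j ξ := by
    intro i
    have h1 : V i = ∑ j, fourierL2 (lBullet f i j (u j)) := map_sum fourierL2 _ _
    rw [h1]
    have h2 := ae_all_iff.2 fun j => fourierL2_lBullet f i j (u j)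
    filter_upwards [h2, Lp.coeFn_fun_finsetSum Finset.univ
      (fun j => fourierL2 (lBullet f i j (u j)))] with ξ h3 h4
    rw [h4]
    exact Finset.sum_congr rfl fun j _ => h3 j
  have hL : ∀ i, (inner ℂ (u i) (∑ j, lBullet f i j (u j))).re =
      ∫ ξ, (inner ℂ (U i ξ) (V i ξ)).re := by
    intro i
    rw [← fourierL2.inner_map_map, L2.inner_def]
    exact (integral_re (L2.integrable_inner (𝕜 := ℂ) (U i) (V i))).symm
  have hRt : ∀ i, ‖u i‖ ^ 2 = ∫ ξ, ‖U i ξ‖ ^ 2 := by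
    intro i
    rw [← re_inner_self_eq, ← fourierL2.inner_map_map, L2.inner_def]
    refine (integral_re (L2.integrable_inner (𝕜 := ℂ) (U i) (U i))).symm.trans ?_
    congr 1
    ext ξ
    exact inner_self_eq_norm_sq (𝕜 := ℂ) _
  have hint : ∀ i, Integrable (fun ξ => (inner ℂ (U i ξ) (V i ξ)).re) (volume : Measure R3) :=
    fun i => (L2.integrable_inner (𝕜 := ℂ) (U i) (V i)).re
  have hint' : ∀ i, Integrable (fun ξ => ‖U i ξ‖ ^ 2) (volume : Measure R3) := fun i => by
    have h := (L2.integrable_inner (𝕜 := ℂ) (U i) (U i)).re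
    refine h.congr (Eventually.of_forall fun ξ => ?_)
    exact inner_self_eq_norm_sq (𝕜 := ℂ) _
  simp only [hL, hRt]
  rw [← integral_finsetSum _ fun i _ => hint i, ← integral_finsetSum _ fun i _ => hint' i,
    ← integral_const_mul]
  refine integral_mono_ae (integrable_finsetSum _ fun i _ => hint i)
    ((integrable_finsetSum _ fun i _ => hint' i).const_mul _) ?_
  filter_upwards [ae_all_iff.2 hVae] with ξ hξ
  simp only [hξ]
  exact re_lBulletSymbol_form_le hf ξ fun i => U i ξ

end BoundedPart

/-! ### The full operator: dissipativity, dense domain and surjectivity -/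

section VectorOperator

theorem linearizedOperator_apply (ν f : ℝ) (u : (linearizedOperator ν f).domain) (i : Fin 3) :
    linearizedOperator ν f u i = lStar ν ⟨(u : L2Vec) i, u.2 i⟩ +
      ∑ j, lBullet f i j ((u : L2Vec) j) := rfl

theorem re_inner_linearizedOperator_le {ν f : ℝ} (hν : 0 ≤ ν) (hf : f ≤ 1)
    (u : (linearizedOperator ν f).domain) :
    (inner ℂ (u : L2Vec) (linearizedOperator ν f u)).re ≤ (2 - f) / 2 * ‖(u : L2Vec)‖ ^ 2 := by
  rw [PiLp.inner_apply, Complex.re_sum, PiLp.norm_sq_eq_of_L2]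
  refine le_trans (Finset.sum_le_sum fun i _ => ?_) (re_inner_lBullet_le hf fun i => (u : L2Vec) i)
  rw [linearizedOperator_apply, inner_add_right, Complex.add_re]
  have := re_inner_lStar_nonpos hν ⟨(u : L2Vec) i, u.2 i⟩
  dsimp only at this
  linarith

theorem dense_linearizedOperator_domain (ν f : ℝ) :
    Dense ((linearizedOperator ν f).domain : Set L2Vec) := by
  have h1 : Dense ((lStar ν).domain : Set L2) :=
    denseRange_schwartzToL2.mono (Set.range_subset_iff.2 (schwartzToL2_mem_lStar_domain ν))
  have h2 : Dense (Set.pi Set.univ fun _ : Fin 3 => ((lStar ν).domain : Set L2)) :=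
    dense_pi _ fun _ _ => h1
  have h3 := h2.preimage (PiLp.continuousLinearEquiv 2 ℂ fun _ : Fin 3 => L2).toHomeomorph.isOpenMap
  exact h3.mono fun u (hu : ∀ i ∈ Set.univ, u i ∈ _) i => hu i (Set.mem_univ i)

/-- The operator on `[L²(ℝ³)]³` with given components. -/
def vecOp (C : Fin 3 → L2Vec →L[ℂ] L2) : L2Vec →L[ℂ] L2Vec :=
  (PiLp.continuousLinearEquiv 2 ℂ fun _ : Fin 3 => L2).symm.toContinuousLinearMap ∘L
    ContinuousLinearMap.pi C

theorem vecOp_apply (C : Fin 3 → L2Vec →L[ℂ] L2) (u : L2Vec) (i : Fin 3) :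
    vecOp C u i = C i u := rfl

/-- With `S` the componentwise resolvent of `νΔ - y∂ₓ` and `B` the bounded part, `u = S h` solves
the equation once `h - B S h = g`. Dissipativity gives `‖S‖ ≤ 1/l`, so `1 - B S` is invertible as
soon as `l > ‖B‖`. -/
theorem linearizedOperator_surjective {ν : ℝ} (f : ℝ) (hν : 0 < ν) :
    ∃ l₀ : ℝ, ∀ l, l₀ ≤ l → ∀ g : L2Vec, ∃ u : (linearizedOperator ν f).domain,
      (l : ℂ) • (u : L2Vec) - linearizedOperator ν f u = g := by
  let B : L2Vec →L[ℂ] L2Vec := vecOp fun i => ∑ j, lBullet f i j ∘L PiLp.proj 2 _ j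
  have hB : ∀ u i, B u i = ∑ j, lBullet f i j (u j) := fun u i => by
    simp [B, vecOp_apply]
  have hκ := ellipticScale_pos
  refine ⟨ν / ellipticScale + 1 + ‖B‖, fun l hl g => ?_⟩
  have hνκ : 0 < ν / ellipticScale := by positivity
  have hl0 : 0 < l := by linarith [norm_nonneg B]
  obtain ⟨R, hR, -, hRn⟩ := exists_resolvent (A := lStar ν) (c := 0)
    (fun u => by rw [zero_mul]; exact re_inner_lStar_nonpos hν.le u) hl0
    (lStar_surjective hν (by linarith [norm_nonneg B]))
  let S : L2Vec →L[ℂ] L2Vec := vecOp fun i => R ∘L PiLp.proj 2 _ i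
  have hS : ∀ u i, S u i = R (u i) := fun u i => rfl
  have hSn : ‖S‖ ≤ l⁻¹ := by
    refine ContinuousLinearMap.opNorm_le_bound _ (by positivity) fun u => ?_
    refine le_of_sq_le_sq ?_ (by positivity)
    rw [mul_pow, PiLp.norm_sq_eq_of_L2, PiLp.norm_sq_eq_of_L2, Finset.mul_sum]
    refine Finset.sum_le_sum fun i _ => ?_
    rw [hS, ← mul_pow]
    gcongr
    rw [← div_eq_inv_mul, le_div_iff₀' hl0]
    simpa using hRn (u i)
  have hBS : ‖B ∘L S‖ < 1 := by
    refine (ContinuousLinearMap.opNorm_comp_le _ _).trans_lt ?_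
    calc ‖B‖ * ‖S‖ ≤ ‖B‖ * l⁻¹ := by gcongr
      _ < l * l⁻¹ := by gcongr; linarith
      _ = 1 := mul_inv_cancel₀ hl0.ne'
  obtain ⟨W, hW⟩ := isUnit_one_sub_of_norm_lt_one hBS
  set h : L2Vec := (↑W⁻¹ : L2Vec →L[ℂ] L2Vec) g
  have hh : h - B (S h) = g := by
    have h1 : (↑W * ↑W⁻¹ : L2Vec →L[ℂ] L2Vec) g = g := by rw [W.mul_inv]; rfl
    rw [hW] at h1
    exact h1
  choose hmem hReq using hR
  refine ⟨⟨S h, fun i => hmem (h i)⟩, ?_⟩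
  conv_rhs => rw [← hh]
  ext1 i
  rw [PiLp.sub_apply, PiLp.sub_apply, PiLp.smul_apply, linearizedOperator_apply, ← sub_sub, hB]
  congr 1
  exact hReq (h i)

end VectorOperator

end CouetteCoriolis

end

theorem mainTheorem4 (ν f : ℝ) (hν : 0 < ν) (hf₀ : 0 < f) (hf₁ : f < 1) :
    (∃ T : ℝ≥0 → CouetteCoriolis.L2Vec →L[ℂ] CouetteCoriolis.L2Vec,
      CouetteCoriolis.Generates (CouetteCoriolis.linearizedOperator ν f) T) ∧
    ∀ T : ℝ≥0 → CouetteCoriolis.L2Vec →L[ℂ] CouetteCoriolis.L2Vec,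
      CouetteCoriolis.Generates (CouetteCoriolis.linearizedOperator ν f) T →
        ∀ t : ℝ≥0, ‖T t‖ ≤ Real.exp ((t : ℝ) * ((2 - f) / 2)) := by
  have hd := CouetteCoriolis.dense_linearizedOperator_domain ν f
  have hdiss := CouetteCoriolis.re_inner_linearizedOperator_le hν.le hf₁.le
  obtain ⟨l₀, hsurj⟩ := CouetteCoriolis.linearizedOperator_surjective f hν
  refine ⟨CouetteCoriolis.exists_generates_of_dissipative hd (by linarith) hdiss hsurj,
    fun T hT t => ?_⟩
  rw [mul_comm]
  exact hT.norm_le hd hdiss t
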